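/- Let $d\in\mathbb N$. For $\tau>0$ let $\gamma_\tau$ be the Gaussian measure on $\mathbb R^d$ with density $(2\pi\tau)^{-d/2}\exp(-|x|^2/2\tau)$, and put $\gamma=\gamma_1$. Let $L$ be the Ornstein–Uhlenbeck operator on $L^2(\mathbb R^d,\gamma)$, that is, the closure of $f\mapsto -\Delta f+x\cdot\nabla f$ on $C_c^2(\mathbb R^d)$, and let $\exp(-zL)$ denote the time-one operator of the strongly continuous semigroup on $L^2(\mathbb R^d,\gamma)$ generated by $-zL$. For $s\in\mathbb C$ with $\operatorname{Re}s>0$ put $r_\pm(s)=\tfrac12\operatorname{Re}(\tfrac1s\pm s)$. Let $p,q,r\in[1,\infty)$ satisfy $\frac1r=1-(\frac1p-\frac1q)$ and let $\alpha,\beta>0$. Let $s\in\mathbb C$ with $\operatorname{Re}s>0$ satisfy $$1-\tfrac{2}{\alpha p}+r_+(s)>0,\qquad \tfrac{2}{\beta q}-1+r_+(s)>0,\qquad (r_-(s))^2\le\bigl(1-\tfrac{2}{\alpha p}+r_+(s)\bigr)\bigl(\tfrac{2}{\beta q}-1+r_+(s)\bigr),$$ and let $z\in\mathbb C$ be such that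 $s=\frac{1-e^{-z}}{1+e^{-z}}$. Then $\exp(-zL)$ is a well-defined bounded operator on $L^2(\mathbb R^d,\gamma)$ (that is, the semigroup exists and its time-one operator is uniquely determined), and it is bounded from $L^p(\mathbb R^d,\gamma_\alpha)$ to $L^q(\mathbb R^d,\gamma_\beta)$, in the sense that its restriction to $L^2(\mathbb R^d,\gamma)\cap L^p(\mathbb R^d,\gamma_\alpha)$ extends to a bounded linear operator between these spaces, with norm $$\|\exp(-zL)\|_{\mathscr L(L^p(\gamma_\alpha),L^q(\gamma_\beta))}\le \frac{2^dC}{|1-e^{-2z}|^{d/2}}\cdot\frac{1}{\bigl(1-\frac{2}{\alpha p}+\operatorname{Re}\frac{1+e^{-2z}}{1-e^{-2z}}\bigr)^{\frac d2(1-\frac1p)}\bigl(\frac{2}{\beta q}-1+\operatorname{Re}\frac{1+e^{-2z}}{1-e^{-2z}}\bigr)^{\frac d2\cdot\frac1q}},$$ where $C=\bigl(\tfrac{1}{2r}\bigr)^{d/2}\bigl(\tfrac{\alpha r}{2}\bigr)^{d/2p}\bigl(\tfrac{\beta r}{2}\bigr)^{-d/2q}$. -/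

import Mathlib

open MeasureTheory Filter Topology
open scoped NNReal ENNReal

noncomputable section

/-- The centred Gaussian measure `γ_τ` on `ℝ^d`, with density
`(2πτ)^{-d/2} exp(-|x|² / (2τ))` with respect to Lebesgue measure. -/
def gaussianMeasure (d : ℕ) (τ : ℝ) : Measure (EuclideanSpace ℝ (Fin d)) :=
  volume.withDensity fun x =>
    ENNReal.ofReal ((2 * Real.pi * τ) ^ (-(d : ℝ) / 2) * Real.exp (-‖x‖ ^ 2 / (2 * τ)))

/-- The complex Hilbert space `L²(ℝ^d, γ)`, with `γ = γ_1` the standard Gaussian measure. -/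
abbrev GaussL2 (d : ℕ) : Type := Lp ℂ 2 (gaussianMeasure d 1)

/-- The differential expression `-Δf(x) + x · ∇f(x)`. -/
def ornsteinUhlenbeck {d : ℕ} (f : EuclideanSpace ℝ (Fin d) → ℂ)
    (x : EuclideanSpace ℝ (Fin d)) : ℂ :=
  -(Laplacian.laplacian f x) + fderiv ℝ f x x

/-- The graph, in `L²(γ) × L²(γ)`, of `f ↦ -Δf + x · ∇f` with domain `C_c²(ℝ^d)`. -/
def ouCoreGraph (d : ℕ) : Set (GaussL2 d × GaussL2 d) :=
  {w | ∃ f : EuclideanSpace ℝ (Fin d) → ℂ, ContDiff ℝ 2 f ∧ HasCompactSupport f ∧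
    w.1 =ᵐ[gaussianMeasure d 1] f ∧ w.2 =ᵐ[gaussianMeasure d 1] ornsteinUhlenbeck f}

/-- The graph of the Ornstein-Uhlenbeck operator `L` on `L²(γ)`: the closure of
`-Δ + x · ∇` on `C_c²(ℝ^d)`. -/
def ouGraph (d : ℕ) : Set (GaussL2 d × GaussL2 d) := closure (ouCoreGraph d)

/-- A strongly continuous one-parameter semigroup of bounded operators. -/
structure C0Semigroup (H : Type*) [NormedAddCommGroup H] [NormedSpace ℂ H] where
  toFun : ℝ≥0 → H →L[ℂ] H
  map_zero : toFun 0 = ContinuousLinearMap.id ℂ H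
  map_add : ∀ s t, toFun (s + t) = (toFun s).comp (toFun t)
  strongly_continuous : ∀ u, Continuous fun t => toFun t u

/-- The graph of the infinitesimal generator: the pairs `(u, v)` such that
`(S(t)u - u)/t → v` as `t ↓ 0`. -/
def C0Semigroup.generatorGraph {H : Type*} [NormedAddCommGroup H] [NormedSpace ℂ H]
    (S : C0Semigroup H) : Set (H × H) :=
  {w | Tendsto (fun t : ℝ≥0 => (((t : ℝ) : ℂ)⁻¹) • (S.toFun t w.1 - w.1)) (𝓝[>] 0) (𝓝 w.2)}

/-- `T = exp(-zL)`: the operator `-zL` (with the domain of `L`) generates a strongly continuous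
semigroup `S` on `L²(γ)`, and `T = S(1)`. -/
def IsExpNegOU (d : ℕ) (z : ℂ) (T : GaussL2 d →L[ℂ] GaussL2 d) : Prop :=
  ∃ S : C0Semigroup (GaussL2 d),
    S.generatorGraph = {w | ∃ v, (w.1, v) ∈ ouGraph d ∧ w.2 = -(z • v)} ∧ S.toFun 1 = T

/-- The operator `T` on `L²(γ)` is bounded from `L^p(γ_α)` to `L^q(γ_β)` with norm at most `K`:
there is a linear `B : L^p(γ_α) → L^q(γ_β)` with `‖B v‖ ≤ K ‖v‖` that agrees with `T` on all
functions (in particular on `C_c^∞`) that lie in both `L²(γ)` and `L^p(γ_α)`. -/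
def ExtendsWithNormLE {d : ℕ} (T : GaussL2 d →L[ℂ] GaussL2 d) (p α q β K : ℝ) : Prop :=
  ∃ B : Lp ℂ (ENNReal.ofReal p) (gaussianMeasure d α) →ₗ[ℂ]
      Lp ℂ (ENNReal.ofReal q) (gaussianMeasure d β),
    (∀ v, ‖B v‖ ≤ K * ‖v‖) ∧
    ∀ (u : GaussL2 d) (v : Lp ℂ (ENNReal.ofReal p) (gaussianMeasure d α)),
      u =ᵐ[volume] v → B v =ᵐ[volume] T u

/-- `r_+(s) = ½ Re(1/s + s)`. -/
def rPlus (s : ℂ) : ℝ := (1 / 2) * (1 / s + s).re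

/-- `r_-(s) = ½ Re(1/s - s)`. -/
def rMinus (s : ℂ) : ℝ := (1 / 2) * (1 / s - s).re

/-- The numerical constant `C = (1/(2r))^{d/2} (αr/2)^{d/(2p)} (βr/2)^{-d/(2q)}`. -/
def schurConst (d : ℕ) (p q r α β : ℝ) : ℝ :=
  (1 / (2 * r)) ^ ((d : ℝ) / 2) * (α * r / 2) ^ ((d : ℝ) / (2 * p)) *
    (β * r / 2) ^ (-((d : ℝ) / (2 * q)))

end

/-! Put `w = exp (-z)`. As `s = (1 - w) / (1 + w)`, the condition `0 < s.re` forces `‖w‖ < 1`, that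
is, `0 < z.re`.

The operator `L` is diagonal. On `C_c²` it is symmetric, since integration by parts against the
Gaussian density turns `⟨g, L f⟩` into the Dirichlet form (`inner_ouGraph_comm`). Cutoffs put `C²`
functions of exponential growth into the domain of the closure. There `L` sends `⟨ξ, x⟩ ^ n` to `n
⟨ξ, x⟩ ^ n` plus a multiple of `⟨ξ, x⟩ ^ (n - 2)`, so these powers are sums of eigenvectors with
eigenvalues at most `n`. They are total: their series give `exp (i ⟨ξ, x⟩)`, and the Fourier
transform is injective. This yields an orthonormal eigenbasis (`exists_hilbertBasis_ou`) in which
the closed graph is described coordinate by coordinate (`mem_ouGraph_iff`). Multiplying the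
coordinates by `exp (-t z N i)` gives a semigroup with generator `-zL`, and any semigroup with that
generator must act so on eigenvectors (`existsUnique_isExpNegOU`).

The exponentials `expVec a ξ` are generating functions of the eigenvectors, and `exp (-zL)` replaces
the parameter `a` by `w * a` (`IsExpNegOU.apply_expVec`). A Gaussian integral shows that Mehler's
kernel acts in the same way for `a = i`; by totality it is the kernel of `exp (-zL)`
(`IsExpNegOU.ae_eq_integral`).

Once the densities of `γ_α` and `γ_β` are moved into the kernel, its modulus is a constant times
`exp (-(Q |x|² - 2 R ⟨x, y⟩ + P |y|²) / 4)`, where `P` and `Q` are the two quantities assumed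
positive and `R = r_-(s)`. The hypothesis `R² ≤ P Q` allows completing the square in either
variable, so the `r`-th power of the kernel has integrals bounded uniformly in the other variable.
The Schur test (`schur_test`) turns these two bounds into the norm estimate, and
`weightedMehlerConst_eq` evaluates the constant. -/

/-! ### Coordinates and diagonal operators in a Hilbert basis -/

section HilbertBasis

variable {ι H : Type*} [NormedAddCommGroup H] [InnerProductSpace ℂ H]

theorem HilbertBasis.hasSum_sq_norm_inner (b : HilbertBasis ι ℂ H) (x : H) :
    HasSum (fun i => ‖inner ℂ (b i) x‖ ^ 2) (‖x‖ ^ 2) := by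
  have h := b.hasSum_inner_mul_inner x x
  rw [inner_self_eq_norm_sq_to_K] at h
  have h2 : (fun i => inner ℂ x (b i) * inner ℂ (b i) x)
      = fun i => ((‖inner ℂ (b i) x‖ ^ 2 : ℝ) : ℂ) := by
    funext i
    rw [← inner_conj_symm x (b i)]
    push_cast
    exact Complex.conj_mul' _
  rw [h2] at h
  have h3 : ((‖x‖ : ℂ)) ^ 2 = ((‖x‖ ^ 2 : ℝ) : ℂ) := by push_cast; rfl
  exact Complex.hasSum_ofReal.1 (h3 ▸ h)

theorem HilbertBasis.ext_inner (b : HilbertBasis ι ℂ H) {x y : H}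
    (h : ∀ i, inner ℂ (b i) x = inner ℂ (b i) y) : x = y := by
  apply b.repr.injective
  ext i
  rw [b.repr_apply_apply, b.repr_apply_apply, h]

/-- By Parseval the squared distance is the sum of the squared coordinate errors, and dominated
convergence for series applies with the majorant `g i ^ 2`. -/
theorem HilbertBasis.tendsto_of_tendsto_inner {α : Type*} {l : Filter α}
    (b : HilbertBasis ι ℂ H) {F : α → H} {v : H} {g : ι → ℝ}
    (hg : Summable fun i => g i ^ 2)
    (hle : ∀ᶠ a in l, ∀ i, ‖inner ℂ (b i) (F a) - inner ℂ (b i) v‖ ≤ g i)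
    (hlim : ∀ i, Tendsto (fun a => inner ℂ (b i) (F a)) l (𝓝 (inner ℂ (b i) v))) :
    Tendsto F l (𝓝 v) := by
  rw [tendsto_iff_norm_sub_tendsto_zero]
  have h2 : Tendsto (fun a => ‖F a - v‖ ^ 2) l (𝓝 0) := by
    have h3 : Tendsto (fun a => ∑' i, ‖inner ℂ (b i) (F a) - inner ℂ (b i) v‖ ^ 2) l
        (𝓝 (∑' _ : ι, (0 : ℝ))) := by
      refine tendsto_tsum_of_dominated_convergence hg (fun i => ?_) ?_
      · have := ((hlim i).sub_const (inner ℂ (b i) v)).norm.pow 2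
        simpa using this
      · filter_upwards [hle] with a ha i
        rw [Real.norm_of_nonneg (by positivity)]
        exact pow_le_pow_left₀ (norm_nonneg _) (ha i) 2
    rw [tsum_zero] at h3
    refine h3.congr fun a => ?_
    simp_rw [← inner_sub_right]
    exact (b.hasSum_sq_norm_inner _).tsum_eq
  have h4 := h2.sqrt
  simpa [Real.sqrt_sq] using h4

theorem HilbertBasis.exists_vector (b : HilbertBasis ι ℂ H) {c : ι → ℂ}
    (hc : Summable fun i => ‖c i‖ ^ 2) : ∃ v : H, ∀ i, inner ℂ (b i) v = c i := by
  have hm : Memℓp c 2 := by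
    apply memℓp_gen
    simpa using hc
  refine ⟨b.repr.symm ⟨c, hm⟩, fun i => ?_⟩
  rw [← b.repr_apply_apply, LinearIsometryEquiv.apply_symm_apply]

theorem HilbertBasis.exists_diagonal (b : HilbertBasis ι ℂ H) {m : ι → ℂ}
    (hm : ∀ i, ‖m i‖ ≤ 1) :
    ∃ T : H →L[ℂ] H, ∀ u i, inner ℂ (b i) (T u) = m i * inner ℂ (b i) u := by
  have hle : ∀ u i, ‖m i * inner ℂ (b i) u‖ ^ 2 ≤ ‖inner ℂ (b i) u‖ ^ 2 := by
    intro u i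
    rw [norm_mul]
    exact pow_le_pow_left₀ (by positivity) (mul_le_of_le_one_left (norm_nonneg _) (hm i)) 2
  have hex : ∀ u : H, ∃ v : H, ∀ i, inner ℂ (b i) v = m i * inner ℂ (b i) u := fun u =>
    b.exists_vector (Summable.of_nonneg_of_le (fun i => by positivity) (hle u)
      (b.hasSum_sq_norm_inner u).summable)
  choose T hT using hex
  let T' : H →ₗ[ℂ] H :=
    { toFun := T
      map_add' := fun u v => b.ext_inner fun i => by
        simp only [inner_add_right, hT, mul_add]
      map_smul' := fun c u => b.ext_inner fun i => by
        simp only [inner_smul_right, hT, RingHom.id_apply]; ring }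
  refine ⟨T'.mkContinuous 1 fun u => ?_, hT⟩
  rw [one_mul]
  refine le_of_sq_le_sq ?_ (norm_nonneg _)
  refine hasSum_le (fun i => ?_) (b.hasSum_sq_norm_inner (T u)) (b.hasSum_sq_norm_inner u)
  rw [hT]
  exact hle u i

end HilbertBasis

/-! ### Diagonal semigroups, and semigroups acting on eigenvectors -/

section Semigroup

variable {ι H : Type*} [NormedAddCommGroup H] [InnerProductSpace ℂ H]

theorem norm_exp_mul_le_one {c : ℂ} (hc : c.re ≤ 0) (t : ℝ≥0) :
    ‖Complex.exp ((t : ℝ) * c)‖ ≤ 1 := by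
  rw [Complex.norm_exp, Complex.re_ofReal_mul]
  exact Real.exp_le_one_iff.2 (mul_nonpos_of_nonneg_of_nonpos t.2 hc)

/-- Mean value inequality on `[0, t]`: the derivative has norm at most `‖c‖`. It dominates the
difference quotients at the origin uniformly in `t`. -/
theorem norm_exp_mul_sub_one_le {c : ℂ} (hc : c.re ≤ 0) (t : ℝ≥0) :
    ‖Complex.exp ((t : ℝ) * c) - 1‖ ≤ t * ‖c‖ := by
  have h := (convex_Icc (0 : ℝ) t).norm_image_sub_le_of_norm_hasDerivWithin_le
    (f := fun x : ℝ => Complex.exp (x * c)) (f' := fun x : ℝ => Complex.exp (x * c) * c)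
    (C := ‖c‖) (x := 0) (y := t)
    (fun x _ => by
      have h1 : HasDerivAt (fun x : ℝ => (x : ℂ) * c) c x := by
        simpa using (Complex.ofRealCLM.hasDerivAt (x := x)).mul_const c
      exact h1.cexp.hasDerivWithinAt)
    (fun x hx => by
      rw [norm_mul]
      exact mul_le_of_le_one_left (norm_nonneg _) (norm_exp_mul_le_one hc ⟨x, hx.1⟩))
    ⟨le_rfl, t.2⟩ ⟨t.2, le_rfl⟩
  simpa [mul_comm] using h

/-- The generator has the maximal domain on which multiplication by `c` makes sense. Taking
coordinates of the limit gives one inclusion; the other one upgrades coordinatewise limits to norm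
limits by domination. -/
theorem HilbertBasis.exists_c0Semigroup (b : HilbertBasis ι ℂ H) {c : ι → ℂ}
    (hc : ∀ i, (c i).re ≤ 0) :
    ∃ S : C0Semigroup H,
      (∀ t u i, inner ℂ (b i) (S.toFun t u) = Complex.exp ((t : ℝ) * c i) * inner ℂ (b i) u) ∧
      S.generatorGraph = {w | ∀ i, inner ℂ (b i) w.2 = c i * inner ℂ (b i) w.1} := by
  choose T hT using fun t : ℝ≥0 => b.exists_diagonal (m := fun i => Complex.exp ((t : ℝ) * c i))
    fun i => norm_exp_mul_le_one (hc i) t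
  let S : C0Semigroup H :=
    { toFun := T
      map_zero := by
        ext u
        exact b.ext_inner fun i => by simp [hT]
      map_add := fun s t => by
        ext u
        refine b.ext_inner fun i => ?_
        rw [ContinuousLinearMap.comp_apply, hT, hT, hT, ← mul_assoc, ← Complex.exp_add]
        push_cast
        rw [add_mul]
      strongly_continuous := fun u => by
        rw [continuous_iff_continuousAt]
        intro t
        refine b.tendsto_of_tendsto_inner (g := fun i => 2 * ‖inner ℂ (b i) u‖) ?_
          (Eventually.of_forall fun s i => ?_) fun i => ?_
        · simp_rw [mul_pow]
          exact (b.hasSum_sq_norm_inner u).summable.mul_left _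
        · rw [hT, hT, ← sub_mul, norm_mul]
          gcongr
          refine (norm_sub_le _ _).trans ?_
          linarith [norm_exp_mul_le_one (hc i) s, norm_exp_mul_le_one (hc i) t]
        · simp_rw [hT]
          refine Continuous.tendsto (f := fun s : ℝ≥0 =>
            Complex.exp ((s : ℝ) * c i) * inner ℂ (b i) u) ?_ t
          fun_prop }
  refine ⟨S, hT, ?_⟩
  have hS : ∀ t, S.toFun t = T t := fun _ => rfl
  have hlim : ∀ i u, Tendsto (fun t : ℝ≥0 => inner ℂ (b i)
      ((((t : ℝ) : ℂ)⁻¹) • (S.toFun t u - u))) (𝓝[>] 0) (𝓝 (c i * inner ℂ (b i) u)) := by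
    intro i u
    simp_rw [hS, inner_smul_right, inner_sub_right, hT, ← sub_one_mul, ← mul_assoc]
    refine Tendsto.mul_const _ ?_
    have h1 : HasDerivAt (fun x : ℝ => Complex.exp (x * c i)) (c i) 0 := by
      have h2 : HasDerivAt (fun x : ℝ => (x : ℂ) * c i) (c i) 0 := by
        simpa using (Complex.ofRealCLM.hasDerivAt (x := 0)).mul_const (c i)
      simpa using h2.cexp
    have h3 := h1.tendsto_slope_zero_right
    have h4 : Tendsto (fun t : ℝ≥0 => (t : ℝ)) (𝓝[>] 0) (𝓝[>] 0) := by
      refine tendsto_nhdsWithin_iff.2 ⟨?_, ?_⟩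
      · exact (NNReal.continuous_coe.tendsto 0).mono_left nhdsWithin_le_nhds
      · filter_upwards [self_mem_nhdsWithin] with t ht
        exact NNReal.coe_pos.2 ht
    refine (h3.comp h4).congr fun t => ?_
    simp
  ext w
  constructor
  · intro hw i
    refine tendsto_nhds_unique ?_ (hlim i w.1)
    exact (Continuous.tendsto (by fun_prop) w.2).comp hw
  · intro hw
    -- The difference quotient is at most `‖c i‖ * ‖⟨b i, w.1⟩‖`, which is `‖⟨b i, w.2⟩‖` by
    -- assumption; the limit contributes the same amount, hence the factor 2.
    refine b.tendsto_of_tendsto_inner (g := fun i => 2 * ‖inner ℂ (b i) w.2‖) ?_ ?_ fun i => ?_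
    · simp_rw [mul_pow]
      exact (b.hasSum_sq_norm_inner w.2).summable.mul_left _
    · filter_upwards [self_mem_nhdsWithin] with t ht i
      have ht : 0 < (t : ℝ) := NNReal.coe_pos.2 ht
      refine (norm_sub_le _ _).trans ?_
      rw [two_mul]
      gcongr
      rw [hS, inner_smul_right, inner_sub_right, hT, ← sub_one_mul, hw i, norm_mul, norm_mul,
        norm_mul, norm_inv, Complex.norm_real, Real.norm_of_nonneg ht.le, ← mul_assoc]
      gcongr
      rw [inv_mul_le_iff₀ ht]
      exact norm_exp_mul_sub_one_le (hc i) t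
    · rw [hw i]
      exact hlim i w.1

/-- The slope at `x` is `S x` applied to the difference quotient at 0. A generator is a one-sided
limit, so this argument gives only a right derivative, which suffices below. -/
theorem C0Semigroup.hasDerivWithinAt_of_mem_generatorGraph (S : C0Semigroup H) {u v : H}
    (h : (u, v) ∈ S.generatorGraph) {x : ℝ} (hx : 0 ≤ x) :
    HasDerivWithinAt (fun t : ℝ => S.toFun t.toNNReal u) (S.toFun x.toNNReal v) (Set.Ici x) x := by
  rw [← hasDerivWithinAt_Ioi_iff_Ici, hasDerivWithinAt_iff_tendsto_slope' (by simp)]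
  have h1 : Tendsto (fun y : ℝ => (y - x).toNNReal) (𝓝[>] x) (𝓝[>] 0) := by
    refine tendsto_nhdsWithin_iff.2 ⟨?_, ?_⟩
    · have : Continuous fun y : ℝ => (y - x).toNNReal := by fun_prop
      have h2 := this.tendsto x
      simp only [sub_self, Real.toNNReal_zero] at h2
      exact h2.mono_left nhdsWithin_le_nhds
    · filter_upwards [self_mem_nhdsWithin] with y hy
      exact Real.toNNReal_pos.2 (sub_pos.2 hy)
  have h3 := ((S.toFun x.toNNReal).continuous.tendsto v).comp (Tendsto.comp h h1)
  refine h3.congr' ?_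
  filter_upwards [self_mem_nhdsWithin] with y hy
  have hy : x < y := hy
  have e : y.toNNReal = x.toNNReal + (y - x).toNNReal := by
    rw [← Real.toNNReal_add hx (by linarith)]; congr 1; ring
  simp only [Function.comp_apply, map_smul, map_sub, slope_def_module]
  rw [e, S.map_add, ContinuousLinearMap.comp_apply, Real.coe_toNNReal _ (by linarith),
    ← Complex.ofReal_inv, Complex.coe_smul]

/-- The curve `exp (-t c) • S t u` is continuous with zero right derivative, hence constant. This is
the source of uniqueness. -/
theorem C0Semigroup.apply_eigenvector (S : C0Semigroup H) {u : H} {c : ℂ}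
    (h : (u, c • u) ∈ S.generatorGraph) (t : ℝ≥0) :
    S.toFun t u = Complex.exp ((t : ℝ) * c) • u := by
  have hd : ∀ x : ℝ, HasDerivAt (fun t : ℝ => Complex.exp (-(t * c)))
      (Complex.exp (-(x * c)) * -c) x := fun x => by
    have h2 : HasDerivAt (fun x : ℝ => -((x : ℂ) * c)) (-c) x := by
      have h1 : HasDerivAt (fun x : ℝ => (x : ℂ) * c) c x := by
        simpa using (Complex.ofRealCLM.hasDerivAt (x := x)).mul_const c
      exact h1.neg
    exact h2.cexp
  have h1 := constant_of_has_deriv_right_zero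
    (f := fun t : ℝ => Complex.exp (-(t * c)) • S.toFun t.toNNReal u) (a := 0) (b := t)
    (by
      refine Continuous.continuousOn ?_
      refine Continuous.smul (by fun_prop) ?_
      exact (S.strongly_continuous u).comp continuous_real_toNNReal)
    (fun x hx => by
      have h3 := (hd x).hasDerivWithinAt.smul
        (S.hasDerivWithinAt_of_mem_generatorGraph h hx.1)
      have e : Complex.exp (-(x * c)) • (S.toFun x.toNNReal) (c • u) +
          (Complex.exp (-(x * c)) * -c) • (S.toFun x.toNNReal) u = 0 := by
        rw [map_smul, smul_smul, ← add_smul]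
        simp
      rw [e] at h3
      exact h3) t ⟨t.2, le_rfl⟩
  simp only [Real.toNNReal_coe, Complex.ofReal_zero, zero_mul, neg_zero, Complex.exp_zero,
    Real.toNNReal_zero, S.map_zero, one_smul, ContinuousLinearMap.id_apply] at h1
  conv_rhs => rw [← h1]
  rw [smul_smul, ← Complex.exp_add]
  simp

end Semigroup

/-! ### The Schur test between Lebesgue spaces -/

/-- Pointwise form of the Schur test: three-function Hölder inequality. -/
theorem lintegral_kernel_rpow_le {Y : Type*} [MeasurableSpace Y] {ν : Measure Y}
    {k f : Y → ℝ≥0∞} (hk : AEMeasurable k ν) (hf : AEMeasurable f ν) {p q r : ℝ}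
    (hp : 1 ≤ p) (hq : 1 ≤ q) (hr1 : 1 ≤ r) (hr : 1 / r = 1 - (1 / p - 1 / q)) :
    (∫⁻ y, k y * f y ∂ν) ^ q ≤ (∫⁻ y, k y ^ r * f y ^ p ∂ν) *
      ((∫⁻ y, k y ^ r ∂ν) ^ (1 - 1 / p) * (∫⁻ y, f y ^ p ∂ν) ^ (1 / p - 1 / q)) ^ q := by
  have hp0 : 0 < p := by linarith
  have hq0 : 0 < q := by linarith
  have hr0 : 0 < r := by linarith
  have h1p : 0 ≤ 1 - 1 / p := by
    rw [sub_nonneg, div_le_one hp0]; exact hp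
  have h1r : 0 ≤ 1 / p - 1 / q := by
    have : 1 / r ≤ 1 := by rw [div_le_one hr0]; exact hr1
    linarith
  have h1q : 0 ≤ 1 / q := by positivity
  -- The exponents `1/q`, `1 - 1/p`, `1/p - 1/q` add up to 1, and `k f = (k^r f^p)^(1/q)
  -- (k^r)^(1-1/p) (f^p)^(1/p-1/q)` because `1/q + 1 - 1/p = 1/r`.
  have key := ENNReal.lintegral_prod_norm_pow_le (μ := ν) (Finset.univ : Finset (Fin 3))
    (f := ![fun y => k y ^ r * f y ^ p, fun y => k y ^ r, fun y => f y ^ p])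
    (p := ![1 / q, 1 - 1 / p, 1 / p - 1 / q])
    (by
      intro i _
      fin_cases i
      · exact (hk.pow_const r).mul (hf.pow_const p)
      · exact hk.pow_const r
      · exact hf.pow_const p)
    (by simp [Fin.sum_univ_three]; ring)
    (by
      intro i _
      fin_cases i
      · exact h1q
      · exact h1p
      · exact h1r)
  simp only [Fin.prod_univ_three, Matrix.cons_val_zero, Matrix.cons_val_one,
    Matrix.cons_val_two, Matrix.tail_cons, Matrix.head_cons] at key
  change ∫⁻ y, (k y ^ r * f y ^ p) ^ (1 / q) * (k y ^ r) ^ (1 - 1 / p) *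
      (f y ^ p) ^ (1 / p - 1 / q) ∂ν ≤ _ at key
  have hpt : ∀ y, (k y ^ r * f y ^ p) ^ (1 / q) * (k y ^ r) ^ (1 - 1 / p) *
      (f y ^ p) ^ (1 / p - 1 / q) = k y * f y := by
    intro y
    rw [ENNReal.mul_rpow_of_nonneg _ _ h1q]
    have e1 : (k y ^ r) ^ (1 / q) * (k y ^ r) ^ (1 - 1 / p) = k y := by
      rw [← ENNReal.rpow_add_of_nonneg _ _ h1q h1p, ← ENNReal.rpow_mul]
      have : r * (1 / q + (1 - 1 / p)) = 1 := by
        have : 1 / q + (1 - 1 / p) = 1 / r := by linarith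
        rw [this]; field_simp
      rw [this, ENNReal.rpow_one]
    have e2 : (f y ^ p) ^ (1 / q) * (f y ^ p) ^ (1 / p - 1 / q) = f y := by
      rw [← ENNReal.rpow_add_of_nonneg _ _ h1q h1r, ← ENNReal.rpow_mul]
      have : p * (1 / q + (1 / p - 1 / q)) = 1 := by
        have : 1 / q + (1 / p - 1 / q) = 1 / p := by ring
        rw [this]; field_simp
      rw [this, ENNReal.rpow_one]
    calc _ = ((k y ^ r) ^ (1 / q) * (k y ^ r) ^ (1 - 1 / p)) *
          ((f y ^ p) ^ (1 / q) * (f y ^ p) ^ (1 / p - 1 / q)) := by ring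
      _ = _ := by rw [e1, e2]
  rw [lintegral_congr hpt] at key
  calc _ ≤ _ := ENNReal.rpow_le_rpow key hq0.le
    _ = _ := by
      rw [mul_assoc, ENNReal.mul_rpow_of_nonneg _ _ hq0.le, ← ENNReal.rpow_mul,
        one_div_mul_cancel hq0.ne', ENNReal.rpow_one]

/-- The Schur test for integral operators between different Lebesgue spaces. -/
theorem schur_test {X Y : Type*} [MeasurableSpace X] [MeasurableSpace Y] {μ : Measure X}
    {ν : Measure Y} [SFinite μ] [SFinite ν]
    {k : X → Y → ℝ≥0∞} {f : Y → ℝ≥0∞} (hk : Measurable (Function.uncurry k))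
    (hf : AEMeasurable f ν) {p q r : ℝ}
    (hp : 1 ≤ p) (hq : 1 ≤ q) (hr1 : 1 ≤ r) (hr : 1 / r = 1 - (1 / p - 1 / q)) {A B : ℝ≥0∞}
    (hA : ∀ x, ∫⁻ y, k x y ^ r ∂ν ≤ A) (hB : ∀ y, ∫⁻ x, k x y ^ r ∂μ ≤ B) :
    (∫⁻ x, (∫⁻ y, k x y * f y ∂ν) ^ q ∂μ) ^ (1 / q) ≤
      A ^ (1 - 1 / p) * B ^ (1 / q) * (∫⁻ y, f y ^ p ∂ν) ^ (1 / p) := by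
  have hp0 : 0 < p := by linarith
  have hq0 : 0 < q := by linarith
  have hr0 : 0 < r := by linarith
  have h1p : 0 ≤ 1 - 1 / p := by
    rw [sub_nonneg, div_le_one hp0]; exact hp
  have h1r : 0 ≤ 1 / p - 1 / q := by
    have : 1 / r ≤ 1 := by rw [div_le_one hr0]; exact hr1
    linarith
  have h1q : 0 ≤ 1 / q := by positivity
  set N := ∫⁻ y, f y ^ p ∂ν with hN
  -- `D` bounds the last two Hölder factors uniformly in `x`. Only `k^r f^p` is left to integrate,
  -- and Tonelli reduces it to the bound `B`.
  set D := (A ^ (1 - 1 / p) * N ^ (1 / p - 1 / q)) ^ q with hD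
  have hkf : AEMeasurable (Function.uncurry fun x y => k x y ^ r * f y ^ p) (μ.prod ν) := by
    refine AEMeasurable.mul (hk.pow_const r).aemeasurable ?_
    exact (hf.pow_const p).comp_snd
  have hin : ∫⁻ x, ∫⁻ y, k x y ^ r * f y ^ p ∂ν ∂μ ≤ B * N := by
    rw [lintegral_lintegral_swap hkf]
    calc _ ≤ ∫⁻ y, B * f y ^ p ∂ν := by
          refine lintegral_mono fun y => ?_
          rw [lintegral_mul_const]
          · gcongr; exact hB y
          · exact (hk.comp (measurable_id.prodMk measurable_const)).pow_const r
      _ = B * N := lintegral_const_mul'' _ (hf.pow_const p)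
  have hfin : ∫⁻ x, (∫⁻ y, k x y * f y ∂ν) ^ q ∂μ ≤ B * N * D := by
    calc _ ≤ ∫⁻ x, (∫⁻ y, k x y ^ r * f y ^ p ∂ν) * D ∂μ := by
          refine lintegral_mono fun x => ?_
          refine (lintegral_kernel_rpow_le (k := k x) (hk.comp measurable_prodMk_left).aemeasurable hf
            hp hq hr1 hr).trans ?_
          rw [hD]
          gcongr
          exact hA x
      _ = (∫⁻ x, ∫⁻ y, k x y ^ r * f y ^ p ∂ν ∂μ) * D :=
          lintegral_mul_const'' _ hkf.lintegral_prod_right'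
      _ ≤ _ := by gcongr
  calc _ ≤ (B * N * D) ^ (1 / q) := ENNReal.rpow_le_rpow hfin h1q
    _ = B ^ (1 / q) * (N ^ (1 / q) * N ^ (1 / p - 1 / q)) * A ^ (1 - 1 / p) := by
      rw [ENNReal.mul_rpow_of_nonneg _ _ h1q, ENNReal.mul_rpow_of_nonneg _ _ h1q, hD,
        ← ENNReal.rpow_mul, mul_one_div_cancel hq0.ne', ENNReal.rpow_one]
      ring
    _ = _ := by
      rw [← ENNReal.rpow_add_of_nonneg _ _ h1q h1r]
      have : 1 / q + (1 / p - 1 / q) = 1 / p := by ring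
      rw [this]
      ring

/-! ### Gaussian measures and functions of exponential growth -/

section GaussianMeasure

/-- The density of `gaussianMeasure d τ` with respect to Lebesgue measure. -/
noncomputable def gaussianDensity (d : ℕ) (τ : ℝ) (x : EuclideanSpace ℝ (Fin d)) : ℝ :=
  (2 * Real.pi * τ) ^ (-(d : ℝ) / 2) * Real.exp (-‖x‖ ^ 2 / (2 * τ))

theorem gaussianMeasure_eq (d : ℕ) (τ : ℝ) : gaussianMeasure d τ =
    volume.withDensity fun x => ENNReal.ofReal (gaussianDensity d τ x) := rfl

theorem gaussianDensity_pos (d : ℕ) {τ : ℝ} (hτ : 0 < τ) (x : EuclideanSpace ℝ (Fin d)) :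
    0 < gaussianDensity d τ x := by
  unfold gaussianDensity
  have := Real.pi_pos
  positivity

theorem continuous_gaussianDensity (d : ℕ) (τ : ℝ) : Continuous (gaussianDensity d τ) := by
  unfold gaussianDensity
  fun_prop

theorem measurable_ofReal_gaussianDensity (d : ℕ) (τ : ℝ) :
    Measurable fun x => ENNReal.ofReal (gaussianDensity d τ x) :=
  (continuous_gaussianDensity d τ).measurable.ennreal_ofReal

theorem gaussianMeasure_absolutelyContinuous (d : ℕ) (τ : ℝ) :
    gaussianMeasure d τ ≪ volume := withDensity_absolutelyContinuous _ _

theorem absolutelyContinuous_gaussianMeasure (d : ℕ) {τ : ℝ} (hτ : 0 < τ) :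
    volume ≪ gaussianMeasure d τ := by
  rw [gaussianMeasure_eq]
  refine withDensity_absolutelyContinuous' (measurable_ofReal_gaussianDensity d τ).aemeasurable ?_
  refine Eventually.of_forall fun x => ?_
  simpa using gaussianDensity_pos d hτ x

theorem lintegral_gaussianMeasure {d : ℕ} {τ : ℝ} (f : EuclideanSpace ℝ (Fin d) → ℝ≥0∞) :
    ∫⁻ x, f x ∂gaussianMeasure d τ = ∫⁻ x, ENNReal.ofReal (gaussianDensity d τ x) * f x := by
  rw [gaussianMeasure_eq]
  exact lintegral_withDensity_eq_lintegral_mul_non_measurable _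
    (measurable_ofReal_gaussianDensity d τ) (Eventually.of_forall fun x => ENNReal.ofReal_lt_top) f

theorem integral_gaussianMeasure {d : ℕ} {τ : ℝ} (hτ : 0 < τ) {F : Type*} [NormedAddCommGroup F]
    [NormedSpace ℝ F] (f : EuclideanSpace ℝ (Fin d) → F) :
    ∫ x, f x ∂gaussianMeasure d τ = ∫ x, gaussianDensity d τ x • f x := by
  rw [gaussianMeasure_eq, integral_withDensity_eq_integral_toReal_smul
    (measurable_ofReal_gaussianDensity d τ) (Eventually.of_forall fun x => ENNReal.ofReal_lt_top)]
  refine integral_congr_ae (Eventually.of_forall fun x => ?_)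
  simp [ENNReal.toReal_ofReal (gaussianDensity_pos d hτ x).le]

theorem integrable_gaussianMeasure_iff {d : ℕ} {τ : ℝ} (hτ : 0 < τ) {F : Type*}
    [NormedAddCommGroup F] [NormedSpace ℝ F] (f : EuclideanSpace ℝ (Fin d) → F) :
    Integrable f (gaussianMeasure d τ) ↔ Integrable fun x => gaussianDensity d τ x • f x := by
  rw [gaussianMeasure_eq, integrable_withDensity_iff_integrable_smul'
    (measurable_ofReal_gaussianDensity d τ) (Eventually.of_forall fun x => ENNReal.ofReal_lt_top)]
  refine integrable_congr (Eventually.of_forall fun x => ?_)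
  simp [ENNReal.toReal_ofReal (gaussianDensity_pos d hτ x).le]

/-- Half of the quadratic term absorbs the linear one, at the cost of the factor `exp (c² / (2a))`.
-/
theorem integrable_exp_mul_norm_sub (d : ℕ) {a : ℝ} (ha : 0 < a) (c : ℝ) :
    Integrable fun x : EuclideanSpace ℝ (Fin d) => Real.exp (c * ‖x‖ - a * ‖x‖ ^ 2) := by
  have h1 : Integrable fun x : EuclideanSpace ℝ (Fin d) =>
      Real.exp (c ^ 2 / (2 * a)) * Real.exp (-(a / 2) * ‖x‖ ^ 2) := by
    refine Integrable.const_mul ?_ _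
    have := (GaussianFourier.integrable_cexp_neg_mul_sq_norm_add (V := EuclideanSpace ℝ (Fin d))
      (b := ((a / 2 : ℝ) : ℂ)) (by rw [Complex.ofReal_re]; positivity) 0 0).re
    refine this.congr (Eventually.of_forall fun x => ?_)
    simp only [zero_mul, add_zero, RCLike.re_to_complex]
    rw [← Complex.ofReal_neg, ← Complex.ofReal_pow, ← Complex.ofReal_mul, Complex.exp_ofReal_re]
  refine h1.mono' (by fun_prop) (Eventually.of_forall fun x => ?_)
  rw [Real.norm_of_nonneg (Real.exp_pos _).le, ← Real.exp_add, Real.exp_le_exp]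
  have h2 : c ^ 2 / (2 * a) + -(a / 2) * ‖x‖ ^ 2 - (c * ‖x‖ - a * ‖x‖ ^ 2)
      = (c - a * ‖x‖) ^ 2 / (2 * a) := by
    field_simp
    ring
  have h3 : 0 ≤ (c - a * ‖x‖) ^ 2 / (2 * a) := by positivity
  linarith

theorem integrable_exp_mul_norm_gaussianMeasure (d : ℕ) {τ : ℝ} (hτ : 0 < τ) (c : ℝ) :
    Integrable (fun x => Real.exp (c * ‖x‖)) (gaussianMeasure d τ) := by
  rw [integrable_gaussianMeasure_iff hτ]
  refine ((integrable_exp_mul_norm_sub d (a := 1 / (2 * τ)) (by positivity) c).const_mul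
    ((2 * Real.pi * τ) ^ (-(d : ℝ) / 2))).congr (Eventually.of_forall fun x => ?_)
  simp only [gaussianDensity, smul_eq_mul, mul_assoc, ← Real.exp_add]
  ring_nf

instance isFiniteMeasure_gaussianMeasure_one (d : ℕ) : IsFiniteMeasure (gaussianMeasure d 1) := by
  have := integrable_exp_mul_norm_gaussianMeasure d one_pos 0
  simp only [zero_mul, Real.exp_zero] at this
  exact (integrable_const_iff_isFiniteMeasure one_ne_zero).1 this

theorem memLp_gaussianMeasure_of_le {d : ℕ} {f : EuclideanSpace ℝ (Fin d) → ℂ}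
    (hf : AEStronglyMeasurable f (gaussianMeasure d 1)) {C c : ℝ}
    (h : ∀ x, ‖f x‖ ≤ C * Real.exp (c * ‖x‖)) : MemLp f 2 (gaussianMeasure d 1) := by
  have h1 : MemLp (fun x : EuclideanSpace ℝ (Fin d) => C * Real.exp (c * ‖x‖)) 2
      (gaussianMeasure d 1) := by
    rw [memLp_two_iff_integrable_sq (by fun_prop)]
    refine ((integrable_exp_mul_norm_gaussianMeasure d one_pos (2 * c)).const_mul (C ^ 2)).congr
      (Eventually.of_forall fun x => ?_)
    simp only [mul_pow, ← Real.exp_nat_mul]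
    push_cast
    ring_nf
  exact h1.of_le hf (Eventually.of_forall fun x => (h x).trans (le_abs_self _))

end GaussianMeasure

/-! ### Coordinate formulas and integration by parts -/

section PartialDerivatives

variable {d : ℕ}

/-- The partial derivative in the `i`-th coordinate direction. -/
noncomputable def partialDeriv (i : Fin d) (f : EuclideanSpace ℝ (Fin d) → ℂ)
    (x : EuclideanSpace ℝ (Fin d)) : ℂ :=
  fderiv ℝ f x (EuclideanSpace.single i 1)

theorem ContDiff.partialDeriv {f : EuclideanSpace ℝ (Fin d) → ℂ} {m n : WithTop ℕ∞}
    (hf : ContDiff ℝ n f) (hmn : m + 1 ≤ n) (i : Fin d) : ContDiff ℝ m (partialDeriv i f) :=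
  (hf.fderiv_right hmn).clm_apply contDiff_const

theorem HasCompactSupport.partialDeriv {f : EuclideanSpace ℝ (Fin d) → ℂ}
    (hf : HasCompactSupport f) (i : Fin d) : HasCompactSupport (partialDeriv i f) :=
  hf.fderiv_apply ℝ _

theorem norm_partialDeriv_le (i : Fin d) (f : EuclideanSpace ℝ (Fin d) → ℂ)
    (x : EuclideanSpace ℝ (Fin d)) : ‖partialDeriv i f x‖ ≤ ‖fderiv ℝ f x‖ := by
  simpa [partialDeriv] using (fderiv ℝ f x).le_opNorm (EuclideanSpace.single i 1)

theorem ornsteinUhlenbeck_eq_sum {f : EuclideanSpace ℝ (Fin d) → ℂ} (hf : ContDiff ℝ 2 f)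
    (x : EuclideanSpace ℝ (Fin d)) : ornsteinUhlenbeck f x =
      ∑ i, (-partialDeriv i (partialDeriv i f) x + (x i : ℂ) * partialDeriv i f x) := by
  have h1 : Laplacian.laplacian f x = ∑ i, partialDeriv i (partialDeriv i f) x := by
    rw [InnerProductSpace.laplacian_eq_iteratedFDeriv_orthonormalBasis f
      (EuclideanSpace.basisFun (Fin d) ℝ)]
    refine Finset.sum_congr rfl fun i _ => ?_
    rw [iteratedFDeriv_two_apply]
    have h2 : DifferentiableAt ℝ (fderiv ℝ f) x :=
      (hf.fderiv_right (m := 1) (by norm_num)).differentiable (by norm_num) x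
    simp only [partialDeriv, Matrix.cons_val_zero, Matrix.cons_val_one,
      EuclideanSpace.basisFun_apply]
    change _ = fderiv ℝ (fun x => fderiv ℝ f x (EuclideanSpace.single i 1)) x _
    rw [fderiv_clm_apply h2 (by fun_prop)]
    simp
  have h3 : fderiv ℝ f x x = ∑ i, (x i : ℂ) * partialDeriv i f x := by
    have h4 : x = ∑ i, x i • EuclideanSpace.single i (1 : ℝ) := by
      simpa using ((EuclideanSpace.basisFun (Fin d) ℝ).sum_repr x).symm
    conv_lhs => arg 2; rw [h4]
    rw [map_sum]
    refine Finset.sum_congr rfl fun i _ => ?_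
    rw [map_smul, Complex.real_smul]
    rfl
  rw [ornsteinUhlenbeck, h1, h3, Finset.sum_add_distrib, Finset.sum_neg_distrib]

theorem partialDeriv_star (i : Fin d) (f : EuclideanSpace ℝ (Fin d) → ℂ) :
    partialDeriv i (fun x => star (f x)) = fun x => star (partialDeriv i f x) := by
  funext x
  simp only [partialDeriv]
  rw [fderiv_star]
  rfl

theorem partialDeriv_mul {f g : EuclideanSpace ℝ (Fin d) → ℂ} {x : EuclideanSpace ℝ (Fin d)}
    (hf : DifferentiableAt ℝ f x) (hg : DifferentiableAt ℝ g x) (i : Fin d) :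
    partialDeriv i (fun y => f y * g y) x = f x * partialDeriv i g x + partialDeriv i f x * g x := by
  simp only [partialDeriv]
  rw [fderiv_fun_mul hf hg]
  simp [mul_comm]

theorem partialDeriv_gaussianDensity (i : Fin d) (x : EuclideanSpace ℝ (Fin d)) :
    partialDeriv i (fun x => (gaussianDensity d 1 x : ℂ)) x = -(x i) * gaussianDensity d 1 x := by
  have h1 : HasFDerivAt (gaussianDensity d 1)
      (-(gaussianDensity d 1 x) • innerSL ℝ x) x := by
    have h2 := (((hasStrictFDerivAt_norm_sq x).hasFDerivAt.neg.mul_const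
      ((2 * (1 : ℝ))⁻¹)).exp).const_mul ((2 * Real.pi * 1) ^ (-(d : ℝ) / 2))
    have e : gaussianDensity d 1 = fun x => (2 * Real.pi * 1) ^ (-(d : ℝ) / 2) *
        Real.exp (-‖x‖ ^ 2 * (2 * (1 : ℝ))⁻¹) := by
      funext x
      simp only [gaussianDensity, div_eq_mul_inv]
    rw [e]
    refine HasFDerivAt.congr_fderiv h2 ?_
    ext v
    simp
    ring
  have h3 := Complex.ofRealCLM.hasFDerivAt.comp x h1
  have h4 : partialDeriv i (fun x => (gaussianDensity d 1 x : ℂ)) x = _ :=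
    congrArg (fun L => L (EuclideanSpace.single i (1 : ℝ))) h3.fderiv
  rw [h4]
  simp [EuclideanSpace.inner_single_right]
  ring

/-- Integrate by parts against the Gaussian density `φ`: since `∂ᵢ φ = -xᵢ φ`, the derivative
falling on `φ` cancels the drift term. The support of `f` alone makes all integrals converge. -/
theorem integral_mul_ornsteinUhlenbeck {f g : EuclideanSpace ℝ (Fin d) → ℂ}
    (hf : ContDiff ℝ 2 f) (hfs : HasCompactSupport f) (hg : ContDiff ℝ 1 g) :
    ∫ x, g x * ornsteinUhlenbeck f x ∂gaussianMeasure d 1 =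
      ∑ i, ∫ x, partialDeriv i g x * partialDeriv i f x ∂gaussianMeasure d 1 := by
  set φ : EuclideanSpace ℝ (Fin d) → ℂ := fun x => (gaussianDensity d 1 x : ℂ) with hφ
  have hφc : ContDiff ℝ 1 φ := by
    have h : ContDiff ℝ 1 (gaussianDensity d 1) :=
      contDiff_const.mul (((contDiff_norm_sq ℝ).neg.div_const _).exp)
    exact Complex.ofRealCLM.contDiff.comp h
  have hFc : ContDiff ℝ 1 fun x => φ x * g x := hφc.mul hg
  have hD1 : ∀ i, ContDiff ℝ 1 (partialDeriv i f) := fun i => hf.partialDeriv (by norm_num) i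
  have hD2 : ∀ i, Continuous (partialDeriv i (partialDeriv i f)) := fun i =>
    ((hD1 i).partialDeriv (m := 0) (by norm_num) i).continuous
  have hs1 : ∀ i, HasCompactSupport (partialDeriv i f) := fun i => hfs.partialDeriv i
  have hs2 : ∀ i, HasCompactSupport (partialDeriv i (partialDeriv i f)) := fun i =>
    (hs1 i).partialDeriv i
  have hFD : ∀ i, Continuous (partialDeriv i fun x => φ x * g x) := fun i =>
    (hFc.partialDeriv (m := 0) (by norm_num) i).continuous
  have hgD : ∀ i, Continuous (partialDeriv i g) := fun i =>
    (hg.partialDeriv (m := 0) (by norm_num) i).continuous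
  have hx : ∀ i, Continuous fun x : EuclideanSpace ℝ (Fin d) => (x i : ℂ) := fun i => by fun_prop
  have hpt : ∀ i x, partialDeriv i (fun x => φ x * g x) x =
      φ x * partialDeriv i g x - x i * φ x * g x := by
    intro i x
    rw [partialDeriv_mul (hφc.differentiable (by norm_num) x) (hg.differentiable (by norm_num) x),
      partialDeriv_gaussianDensity]
    ring
  have hparts : ∀ i, ∫ x, φ x * g x * partialDeriv i (partialDeriv i f) x =
      -∫ x, partialDeriv i (fun x => φ x * g x) x * partialDeriv i f x := by
    intro i
    refine integral_mul_fderiv_eq_neg_fderiv_mul_of_integrable (f := fun x => φ x * g x)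
      (g := partialDeriv i f) (v := EuclideanSpace.single i 1) ?_ ?_ ?_ ?_ ?_
    · exact ((hFD i).mul (hD1 i).continuous).integrable_of_hasCompactSupport (hs1 i).mul_left
    · exact (hFc.continuous.mul (hD2 i)).integrable_of_hasCompactSupport (hs2 i).mul_left
    · exact (hFc.continuous.mul (hD1 i).continuous).integrable_of_hasCompactSupport
        (hs1 i).mul_left
    · exact fun x _ => hFc.differentiable (by norm_num) x
    · exact fun x _ => (hD1 i).differentiable (by norm_num) x
  have hi1 : ∀ i, Integrable fun x => φ x * g x * partialDeriv i (partialDeriv i f) x := fun i =>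
    (hFc.continuous.mul (hD2 i)).integrable_of_hasCompactSupport (hs2 i).mul_left
  have hi2 : ∀ i, Integrable fun x => φ x * g x * (x i * partialDeriv i f x) := fun i =>
    (hFc.continuous.mul ((hx i).mul (hD1 i).continuous)).integrable_of_hasCompactSupport
      (hs1 i).mul_left.mul_left
  have hi3 : ∀ i, Integrable fun x => φ x * (partialDeriv i g x * partialDeriv i f x) := fun i =>
    (hφc.continuous.mul ((hgD i).mul (hD1 i).continuous)).integrable_of_hasCompactSupport
      (hs1 i).mul_left.mul_left
  simp_rw [integral_gaussianMeasure one_pos, Complex.real_smul]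
  calc _ = ∫ x, ∑ i, (-(φ x * g x * partialDeriv i (partialDeriv i f) x) +
        φ x * g x * (x i * partialDeriv i f x)) := by
        refine integral_congr_ae (Eventually.of_forall fun x => ?_)
        simp only [ornsteinUhlenbeck_eq_sum hf, Finset.mul_sum]
        refine Finset.sum_congr rfl fun i _ => ?_
        ring
    _ = ∑ i, ∫ x, (-(φ x * g x * partialDeriv i (partialDeriv i f) x) +
        φ x * g x * (x i * partialDeriv i f x)) :=
        integral_finsetSum _ fun i _ => (hi1 i).neg.add (hi2 i)
    _ = _ := by
        refine Finset.sum_congr rfl fun i _ => ?_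
        rw [integral_add (f := fun x => -(φ x * g x * partialDeriv i (partialDeriv i f) x))
          (hi1 i).neg (hi2 i), integral_neg, hparts i, neg_neg]
        have h1 : (fun x => partialDeriv i (fun x => φ x * g x) x * partialDeriv i f x) =
            fun x => φ x * (partialDeriv i g x * partialDeriv i f x) -
              φ x * g x * (x i * partialDeriv i f x) := by
          funext x
          rw [hpt]
          ring
        rw [h1, integral_sub (hi3 i) (hi2 i), sub_add_cancel]

end PartialDerivatives

/-- Dominated convergence in `L²`: the squared errors are dominated by `(2 * bound) ^ 2`. It serves
for cutoffs and for power series. -/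
theorem tendsto_toLp_two_of_dominated {α : Type*} [MeasurableSpace α] {μ : Measure α}
    {F : ℕ → α → ℂ} {f : α → ℂ} {bound : α → ℝ} (hF : ∀ n, MemLp (F n) 2 μ) (hf : MemLp f 2 μ)
    (hb : MemLp bound 2 μ) (hle : ∀ n x, ‖F n x‖ ≤ bound x)
    (hlim : ∀ x, Tendsto (fun n => F n x) atTop (𝓝 (f x))) :
    Tendsto (fun n => (hF n).toLp (F n)) atTop (𝓝 (hf.toLp f)) := by
  rw [Lp.tendsto_Lp_iff_tendsto_eLpNorm'']
  have hfle : ∀ x, ‖f x‖ ≤ bound x := fun x =>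
    le_of_tendsto (hlim x).norm (Eventually.of_forall fun n => hle n x)
  have hfin : ∫⁻ x, ‖(2 * bound x)‖ₑ ^ (2 : ℝ) ∂μ ≠ ∞ := by
    have h := (hb.const_mul 2).eLpNorm_lt_top
    rw [eLpNorm_lt_top_iff_lintegral_rpow_enorm_lt_top (by norm_num) (by norm_num)] at h
    simpa using h.ne
  have h1 := tendsto_lintegral_of_dominated_convergence' (μ := μ)
    (F := fun n x => ‖F n x - f x‖ₑ ^ (2 : ℝ)) (f := fun _ => 0)
    (fun x => ‖2 * bound x‖ₑ ^ (2 : ℝ))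
    (fun n => ((hF n).1.sub hf.1).enorm.pow_const _)
    (fun n => Eventually.of_forall fun x => by
      refine ENNReal.rpow_le_rpow ?_ (by norm_num)
      rw [enorm_le_iff_norm_le, Real.norm_eq_abs]
      refine ((norm_sub_le _ _).trans ?_).trans (le_abs_self _)
      linarith [hle n x, hfle x]) hfin
    (Eventually.of_forall fun x => by
      have h2 : Tendsto (fun n => ‖F n x - f x‖ₑ) atTop (𝓝 0) := by
        have := ((hlim x).sub_const (f x)).enorm
        simpa using this
      have h3 := (ENNReal.continuous_rpow_const (y := 2)).tendsto 0 |>.comp h2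
      rw [ENNReal.zero_rpow_of_pos (by norm_num)] at h3
      exact h3)
  simp only [lintegral_zero] at h1
  have h4 := (ENNReal.continuous_rpow_const (y := 1 / 2)).tendsto 0 |>.comp h1
  simp only [ENNReal.zero_rpow_of_pos (show (0 : ℝ) < 1 / 2 by norm_num)] at h4
  refine h4.congr fun n => ?_
  rw [eLpNorm_eq_lintegral_rpow_enorm_toReal (by norm_num) (by norm_num)]
  simp

/-! ### Linearity and symmetry of the closed Ornstein–Uhlenbeck graph -/

section Graph

variable {d : ℕ}

theorem ornsteinUhlenbeck_add {f g : EuclideanSpace ℝ (Fin d) → ℂ} (hf : ContDiff ℝ 2 f)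
    (hg : ContDiff ℝ 2 g) (x : EuclideanSpace ℝ (Fin d)) :
    ornsteinUhlenbeck (f + g) x = ornsteinUhlenbeck f x + ornsteinUhlenbeck g x := by
  simp only [ornsteinUhlenbeck]
  rw [hf.contDiffAt.laplacian_add hg.contDiffAt, fderiv_add
    (hf.differentiable (by norm_num) x) (hg.differentiable (by norm_num) x)]
  simp only [_root_.add_apply]
  ring

theorem ornsteinUhlenbeck_smul {f : EuclideanSpace ℝ (Fin d) → ℂ} (hf : ContDiff ℝ 2 f) (c : ℂ)
    (x : EuclideanSpace ℝ (Fin d)) :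
    ornsteinUhlenbeck (c • f) x = c * ornsteinUhlenbeck f x := by
  have hcf : ContDiff ℝ 2 (c • f) := hf.const_smul c
  rw [ornsteinUhlenbeck_eq_sum hcf, ornsteinUhlenbeck_eq_sum hf, Finset.mul_sum]
  refine Finset.sum_congr rfl fun i _ => ?_
  have h1 : partialDeriv i (c • f) = fun x => c • partialDeriv i f x := by
    funext y
    simp only [partialDeriv]
    rw [fderiv_const_smul (hf.differentiable (by norm_num) y)]
    rfl
  have h2 : partialDeriv i (c • partialDeriv i f) x = c • partialDeriv i (partialDeriv i f) x := by
    simp only [partialDeriv]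
    rw [fderiv_const_smul]
    · rfl
    · exact (hf.partialDeriv (m := 1) (by norm_num) i).differentiable (by norm_num) x
  rw [h1]
  change -partialDeriv i (c • partialDeriv i f) x + _ = _
  rw [h2]
  simp only [smul_eq_mul]
  ring

theorem ornsteinUhlenbeck_congr {f g : EuclideanSpace ℝ (Fin d) → ℂ}
    {x : EuclideanSpace ℝ (Fin d)} (h : f =ᶠ[𝓝 x] g) :
    ornsteinUhlenbeck f x = ornsteinUhlenbeck g x := by
  rw [ornsteinUhlenbeck, ornsteinUhlenbeck, (InnerProductSpace.laplacian_congr_nhds h).eq_of_nhds,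
    h.fderiv_eq]

/-- `ouCoreGraph` as a linear subspace. -/
def ouCoreSubmodule (d : ℕ) : Submodule ℂ (GaussL2 d × GaussL2 d) where
  carrier := ouCoreGraph d
  add_mem' := by
    rintro u v ⟨f, hf, hfs, hf1, hf2⟩ ⟨g, hg, hgs, hg1, hg2⟩
    refine ⟨f + g, hf.add hg, hfs.add hgs, ?_, ?_⟩
    · filter_upwards [Lp.coeFn_add u.1 v.1, hf1, hg1] with x h1 h2 h3
      rw [Prod.fst_add, h1, Pi.add_apply, h2, h3, Pi.add_apply]
    · filter_upwards [Lp.coeFn_add u.2 v.2, hf2, hg2] with x h1 h2 h3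
      rw [Prod.snd_add, h1, Pi.add_apply, h2, h3, ornsteinUhlenbeck_add hf hg]
  zero_mem' := by
    refine ⟨0, contDiff_const, HasCompactSupport.zero, Lp.coeFn_zero _ _ _, ?_⟩
    filter_upwards [Lp.coeFn_zero ℂ 2 (gaussianMeasure d 1)] with x h1
    rw [Prod.snd_zero, h1]
    have h2 := ornsteinUhlenbeck_smul (f := (0 : EuclideanSpace ℝ (Fin d) → ℂ)) contDiff_const 0 x
    simpa using h2.symm
  smul_mem' := by
    rintro c u ⟨f, hf, hfs, hf1, hf2⟩
    refine ⟨c • f, hf.const_smul c, hfs.smul_left (f := fun _ => c), ?_, ?_⟩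
    · filter_upwards [Lp.coeFn_smul c u.1, hf1] with x h1 h2
      rw [Prod.smul_fst, h1, Pi.smul_apply, h2, Pi.smul_apply]
    · filter_upwards [Lp.coeFn_smul c u.2, hf2] with x h1 h2
      rw [Prod.smul_snd, h1, Pi.smul_apply, h2, ornsteinUhlenbeck_smul hf, smul_eq_mul]

/-- The graph of the Ornstein-Uhlenbeck operator as a closed linear subspace. -/
noncomputable def ouSubmodule (d : ℕ) : Submodule ℂ (GaussL2 d × GaussL2 d) :=
  (ouCoreSubmodule d).topologicalClosure

theorem mem_ouSubmodule {w : GaussL2 d × GaussL2 d} : w ∈ ouSubmodule d ↔ w ∈ ouGraph d := Iff.rfl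

/-- Both pairings are Dirichlet forms of the same pair of representatives, so they are visibly
conjugate to each other. -/
theorem inner_ouCoreGraph {w w' : GaussL2 d × GaussL2 d} (hw : w ∈ ouCoreGraph d)
    (hw' : w' ∈ ouCoreGraph d) : ∃ f g : EuclideanSpace ℝ (Fin d) → ℂ,
    inner ℂ w.1 w'.2 = ∑ i, ∫ x, star (partialDeriv i f x) * partialDeriv i g x
      ∂gaussianMeasure d 1 ∧
    inner ℂ w'.1 w.2 = ∑ i, ∫ x, star (partialDeriv i g x) * partialDeriv i f x
      ∂gaussianMeasure d 1 := by
  obtain ⟨f, hf, hfs, hf1, hf2⟩ := hw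
  obtain ⟨g, hg, hgs, hg1, hg2⟩ := hw'
  have key : ∀ {f g : EuclideanSpace ℝ (Fin d) → ℂ} {u v : GaussL2 d}, ContDiff ℝ 2 f →
      ContDiff ℝ 2 g → HasCompactSupport g → u =ᵐ[gaussianMeasure d 1] f →
      v =ᵐ[gaussianMeasure d 1] ornsteinUhlenbeck g →
      inner ℂ u v = ∑ i, ∫ x, star (partialDeriv i f x) * partialDeriv i g x
        ∂gaussianMeasure d 1 := by
    intro f g u v hf hg hgs hu hv
    have hsf : ContDiff ℝ 2 fun x => star (f x) :=
      (starL' ℝ (A := ℂ)).contDiff.comp hf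
    have h := integral_mul_ornsteinUhlenbeck hg hgs (hsf.of_le (by norm_num) : ContDiff ℝ 1 _)
    simp_rw [partialDeriv_star] at h
    rw [← h, L2.inner_def]
    refine integral_congr_ae ?_
    filter_upwards [hu, hv] with x h1 h2
    rw [h1, h2, RCLike.inner_apply, mul_comm]
    rfl
  exact ⟨f, g, key hf hg hgs hf1 hg2, key hg hf hfs hg1 hf2⟩

/-- Symmetry holds on the core and is a closed condition in each argument, so it passes to the
closure one argument at a time. -/
theorem inner_ouGraph_comm {w w' : GaussL2 d × GaussL2 d} (hw : w ∈ ouGraph d)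
    (hw' : w' ∈ ouGraph d) : inner ℂ w.1 w'.2 = inner ℂ w.2 w'.1 := by
  have hcore : ∀ w ∈ ouCoreGraph d, ∀ w' ∈ ouCoreGraph d,
      inner ℂ w.1 w'.2 = inner ℂ w.2 w'.1 := by
    intro w hw w' hw'
    obtain ⟨f, g, h1, h2⟩ := inner_ouCoreGraph hw hw'
    rw [h1, ← inner_conj_symm, h2, map_sum]
    refine Finset.sum_congr rfl fun i _ => ?_
    rw [← integral_conj]
    refine integral_congr_ae (Eventually.of_forall fun x => ?_)
    simp [mul_comm]
  have h1 : ∀ w ∈ ouGraph d, ∀ w' ∈ ouCoreGraph d, inner ℂ w.1 w'.2 = inner ℂ w.2 w'.1 := by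
    intro w hw w' hw'
    have hc : IsClosed {w : GaussL2 d × GaussL2 d | inner ℂ w.1 w'.2 = inner ℂ w.2 w'.1} :=
      isClosed_eq (by fun_prop) (by fun_prop)
    exact closure_minimal (fun w hw => hcore w hw w' hw') hc hw
  have hc : IsClosed {w' : GaussL2 d × GaussL2 d | inner ℂ w.1 w'.2 = inner ℂ w.2 w'.1} :=
    isClosed_eq (by fun_prop) (by fun_prop)
  exact closure_minimal (fun w' hw' => h1 w hw w' hw') hc hw'

end Graph

/-! ### Cutoffs and functions of exponential growth in the domain -/

section Cutoff

variable {d : ℕ}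

theorem ornsteinUhlenbeck_mul {f g : EuclideanSpace ℝ (Fin d) → ℂ} (hf : ContDiff ℝ 2 f)
    (hg : ContDiff ℝ 2 g) (x : EuclideanSpace ℝ (Fin d)) :
    ornsteinUhlenbeck (fun y => f y * g y) x = f x * ornsteinUhlenbeck g x +
      ornsteinUhlenbeck f x * g x - 2 * ∑ i, partialDeriv i f x * partialDeriv i g x := by
  rw [ornsteinUhlenbeck_eq_sum (hf.mul hg), ornsteinUhlenbeck_eq_sum hf,
    ornsteinUhlenbeck_eq_sum hg, Finset.mul_sum, Finset.sum_mul, Finset.mul_sum,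
    ← Finset.sum_add_distrib, ← Finset.sum_sub_distrib]
  refine Finset.sum_congr rfl fun i _ => ?_
  have hdf : Differentiable ℝ f := hf.differentiable (by norm_num)
  have hdg : Differentiable ℝ g := hg.differentiable (by norm_num)
  have hdf' : Differentiable ℝ (partialDeriv i f) :=
    (hf.partialDeriv (m := 1) (by norm_num) i).differentiable (by norm_num)
  have hdg' : Differentiable ℝ (partialDeriv i g) :=
    (hg.partialDeriv (m := 1) (by norm_num) i).differentiable (by norm_num)
  have h1 : partialDeriv i (fun y => f y * g y) =
      fun y => f y * partialDeriv i g y + partialDeriv i f y * g y :=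
    funext fun y => partialDeriv_mul (hdf y) (hdg y) i
  have h2 : partialDeriv i (fun y => f y * partialDeriv i g y + partialDeriv i f y * g y) x =
      partialDeriv i (fun y => f y * partialDeriv i g y) x +
        partialDeriv i (fun y => partialDeriv i f y * g y) x := by
    simp only [partialDeriv]
    rw [fderiv_fun_add]
    · rfl
    · exact (hdf x).mul (hdg' x)
    · exact (hdf' x).mul (hdg x)
  rw [h1, h2, partialDeriv_mul (hdf x) (hdg' x), partialDeriv_mul (hdf' x) (hdg x)]
  ring

theorem partialDeriv_comp_smul (i : Fin d) (f : EuclideanSpace ℝ (Fin d) → ℂ) (c : ℝ) :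
    partialDeriv i (fun x => f (c • x)) = fun x => (c : ℂ) * partialDeriv i f (c • x) := by
  funext x
  simp only [partialDeriv]
  rw [fderiv_comp_smul]
  simp

theorem partialDeriv_partialDeriv_comp_smul {f : EuclideanSpace ℝ (Fin d) → ℂ}
    (hf : ContDiff ℝ 2 f) (i : Fin d) (c : ℝ) (x : EuclideanSpace ℝ (Fin d)) :
    partialDeriv i (partialDeriv i fun x => f (c • x)) x =
      (c : ℂ) ^ 2 * partialDeriv i (partialDeriv i f) (c • x) := by
  have hd : Differentiable ℝ (partialDeriv i f) :=
    (hf.partialDeriv (m := 1) (by norm_num) i).differentiable (by norm_num)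
  rw [partialDeriv_comp_smul]
  have h1 : DifferentiableAt ℝ (fun x => partialDeriv i f (c • x)) x :=
    DifferentiableAt.comp x (hd _) (by fun_prop)
  have h2 : partialDeriv i (fun x => (c : ℂ) * partialDeriv i f (c • x)) x =
      c * partialDeriv i (fun x => partialDeriv i f (c • x)) x := by
    conv_lhs => rw [partialDeriv, fderiv_const_mul h1]
    rfl
  rw [h2, partialDeriv_comp_smul]
  ring

/-- Rescaled cutoff functions with uniformly bounded first derivatives and uniformly bounded
image under the Ornstein-Uhlenbeck operator. -/
theorem exists_cutoff (d : ℕ) : ∃ (χ : ℕ → EuclideanSpace ℝ (Fin d) → ℂ) (K : ℝ), 0 ≤ K ∧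
    (∀ n, ContDiff ℝ 2 (χ n)) ∧ (∀ n, HasCompactSupport (χ n)) ∧
    (∀ n x, ‖χ n x‖ ≤ 1) ∧ (∀ n i x, ‖partialDeriv i (χ n) x‖ ≤ K) ∧
    (∀ n x, ‖ornsteinUhlenbeck (χ n) x‖ ≤ K) ∧ ∀ x, ∀ᶠ n in atTop, χ n =ᶠ[𝓝 x] 1 := by
  let b : ContDiffBump (0 : EuclideanSpace ℝ (Fin d)) := ⟨1, 2, one_pos, one_lt_two⟩
  let ψ : EuclideanSpace ℝ (Fin d) → ℂ := fun x => (b x : ℂ)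
  have hψ : ContDiff ℝ 2 ψ := Complex.ofRealCLM.contDiff.comp b.contDiff
  have hψs : HasCompactSupport ψ := b.hasCompactSupport.comp_left (g := fun r : ℝ => (r : ℂ)) rfl
  have hD1 : ∀ i, ContDiff ℝ 1 (partialDeriv i ψ) := fun i => hψ.partialDeriv (by norm_num) i
  have hs1 : ∀ i, HasCompactSupport (partialDeriv i ψ) := fun i => hψs.partialDeriv i
  choose K1 hK1 using fun i => (hs1 i).exists_bound_of_continuous (hD1 i).continuous
  choose K2 hK2 using fun i => ((hs1 i).partialDeriv i).exists_bound_of_continuous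
    ((hD1 i).partialDeriv (m := 0) (by norm_num) i).continuous
  -- The drift `xᵢ ∂ᵢ` is invariant under dilation: applied to `ψ (ε x)` it is `xᵢ ∂ᵢ ψ` evaluated
  -- at `ε x`. Hence one bound serves every scale although `xᵢ` is unbounded.
  choose K3 hK3 using fun i => ((hs1 i).mul_left
    (f := fun x : EuclideanSpace ℝ (Fin d) => (x i : ℂ))).exists_bound_of_continuous
    (Continuous.mul (by fun_prop) (hD1 i).continuous)
  have hp1 : ∀ i, 0 ≤ K1 i := fun i => (norm_nonneg _).trans (hK1 i 0)
  have hp2 : ∀ i, 0 ≤ K2 i := fun i => (norm_nonneg _).trans (hK2 i 0)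
  have hp3 : ∀ i, 0 ≤ K3 i := fun i => (norm_nonneg _).trans (hK3 i 0)
  let ε : ℕ → ℝ := fun n => ((n : ℝ) + 1)⁻¹
  have hε0 : ∀ n, 0 < ε n := fun n => by positivity
  have hε1 : ∀ n, ε n ≤ 1 := fun n => inv_le_one_of_one_le₀ (by linarith [n.cast_nonneg (α := ℝ)])
  refine ⟨fun n x => ψ (ε n • x), ∑ i, (K1 i + K2 i + K3 i),
    Finset.sum_nonneg fun i _ => by linarith [hp1 i, hp2 i, hp3 i], fun n => ?_, fun n => ?_,
    fun n x => ?_, fun n i x => ?_, fun n x => ?_, fun x => ?_⟩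
  · exact hψ.comp (contDiff_const_smul _)
  · exact hψs.comp_smul (hε0 n).ne'
  · rw [Complex.norm_real, Real.norm_of_nonneg b.nonneg]
    exact b.le_one
  · rw [partialDeriv_comp_smul, norm_mul, Complex.norm_real, Real.norm_of_nonneg (hε0 n).le]
    calc _ ≤ 1 * K1 i := mul_le_mul (hε1 n) (hK1 i _) (norm_nonneg _) zero_le_one
      _ ≤ K1 i + K2 i + K3 i := by linarith [hp2 i, hp3 i]
      _ ≤ _ := Finset.single_le_sum (f := fun i => K1 i + K2 i + K3 i)
        (fun i _ => by linarith [hp1 i, hp2 i, hp3 i]) (Finset.mem_univ i)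
  · have hψn : ContDiff ℝ 2 fun x => ψ (ε n • x) := hψ.comp (contDiff_const_smul _)
    rw [ornsteinUhlenbeck_eq_sum hψn]
    refine norm_sum_le_of_le _ fun i _ => ?_
    rw [partialDeriv_partialDeriv_comp_smul hψ, partialDeriv_comp_smul]
    refine (norm_add_le _ _).trans ?_
    have e1 : ‖-((ε n : ℂ) ^ 2 * partialDeriv i (partialDeriv i ψ) (ε n • x))‖ ≤ K2 i := by
      rw [norm_neg, norm_mul, norm_pow, Complex.norm_real, Real.norm_of_nonneg (hε0 n).le]
      calc _ ≤ 1 * K2 i := mul_le_mul (pow_le_one₀ (hε0 n).le (hε1 n)) (hK2 i _)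
            (norm_nonneg _) zero_le_one
        _ = _ := one_mul _
    have e2 : ‖(x i : ℂ) * ((ε n : ℂ) * partialDeriv i ψ (ε n • x))‖ ≤ K3 i := by
      have h := hK3 i (ε n • x)
      have e3 : (((ε n • x) i : ℝ) : ℂ) * partialDeriv i ψ (ε n • x) =
          (x i : ℂ) * ((ε n : ℂ) * partialDeriv i ψ (ε n • x)) := by
        simp
        ring
      rwa [Pi.mul_apply, e3] at h
    linarith [hp1 i]
  · obtain ⟨N, hN⟩ := exists_nat_gt ‖x‖
    filter_upwards [eventually_ge_atTop N] with n hn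
    have hx : ‖x‖ < n + 1 := by
      have : (N : ℝ) ≤ n := by exact_mod_cast hn
      linarith
    filter_upwards [(isOpen_lt continuous_norm continuous_const).mem_nhds hx] with y hy
    have h1 : b (ε n • y) = 1 := by
      refine b.one_of_mem_closedBall ?_
      rw [mem_closedBall_zero_iff, norm_smul, Real.norm_of_nonneg (hε0 n).le]
      change ((n : ℝ) + 1)⁻¹ * ‖y‖ ≤ 1
      rw [inv_mul_le_iff₀ (by positivity), mul_one]
      exact (show ‖y‖ < n + 1 from hy).le
    change ((b (ε n • y) : ℝ) : ℂ) = 1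
    rw [h1, Complex.ofReal_one]

theorem continuous_ornsteinUhlenbeck {f : EuclideanSpace ℝ (Fin d) → ℂ} (hf : ContDiff ℝ 2 f) :
    Continuous (ornsteinUhlenbeck f) := by
  have h : ornsteinUhlenbeck f = fun x =>
      ∑ i, (-partialDeriv i (partialDeriv i f) x + (x i : ℂ) * partialDeriv i f x) :=
    funext (ornsteinUhlenbeck_eq_sum hf)
  rw [h]
  refine continuous_finsetSum _ fun i _ => ?_
  have h1 : ContDiff ℝ 1 (partialDeriv i f) := hf.partialDeriv (by norm_num) i
  exact (h1.partialDeriv (m := 0) (by norm_num) i).continuous.neg.add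
    (Continuous.mul (by fun_prop) h1.continuous)

/-- Functions of class `C²` with exponentially bounded derivatives lie in the domain of the
Ornstein-Uhlenbeck operator. -/
theorem mem_ouGraph_of_le_exp {f : EuclideanSpace ℝ (Fin d) → ℂ} (hf : ContDiff ℝ 2 f) {C c : ℝ}
    (h0 : ∀ x, ‖f x‖ ≤ C * Real.exp (c * ‖x‖))
    (h1 : ∀ x, ‖fderiv ℝ f x‖ ≤ C * Real.exp (c * ‖x‖))
    (h2 : ∀ x, ‖ornsteinUhlenbeck f x‖ ≤ C * Real.exp (c * ‖x‖))
    (hm : MemLp f 2 (gaussianMeasure d 1))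
    (hm' : MemLp (ornsteinUhlenbeck f) 2 (gaussianMeasure d 1)) :
    (hm.toLp f, hm'.toLp (ornsteinUhlenbeck f)) ∈ ouGraph d := by
  obtain ⟨χ, K, hK, hχ, hχs, hχ0, hχ1, hχ2, hlim⟩ := exists_cutoff d
  have hχf : ∀ n, ContDiff ℝ 2 fun x => χ n x * f x := fun n => (hχ n).mul hf
  have hb0 : ∀ n x, ‖χ n x * f x‖ ≤ C * Real.exp (c * ‖x‖) := fun n x => by
    rw [norm_mul]
    exact (mul_le_of_le_one_left (norm_nonneg _) (hχ0 n x)).trans (h0 x)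
  -- The summands `1`, `K` and `2 d K` bound, in this order, `χ L f`, `f L χ` and the `d` cross
  -- terms `2 ∂ᵢ χ ∂ᵢ f` of the product rule.
  have hb2 : ∀ n x, ‖ornsteinUhlenbeck (fun x => χ n x * f x) x‖ ≤
      ((1 + K + 2 * (d * K)) * C) * Real.exp (c * ‖x‖) := fun n x => by
    set M := C * Real.exp (c * ‖x‖) with hM
    have hM0 : 0 ≤ M := (norm_nonneg _).trans (h0 x)
    rw [ornsteinUhlenbeck_mul (hχ n) hf, mul_assoc (1 + K + 2 * (d * K)), ← hM]
    have e1 : ‖χ n x * ornsteinUhlenbeck f x‖ ≤ M := by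
      rw [norm_mul]
      exact (mul_le_of_le_one_left (norm_nonneg _) (hχ0 n x)).trans (h2 x)
    have e2 : ‖ornsteinUhlenbeck (χ n) x * f x‖ ≤ K * M := by
      rw [norm_mul]
      exact mul_le_mul (hχ2 n x) (h0 x) (norm_nonneg _) hK
    have e3 : ‖∑ i, partialDeriv i (χ n) x * partialDeriv i f x‖ ≤ ∑ _i : Fin d, K * M := by
      refine norm_sum_le_of_le _ fun i _ => ?_
      rw [norm_mul]
      exact mul_le_mul (hχ1 n i x) ((norm_partialDeriv_le i f x).trans (h1 x)) (norm_nonneg _) hK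
    rw [Finset.sum_const, Finset.card_univ, Fintype.card_fin, nsmul_eq_mul] at e3
    calc _ ≤ ‖χ n x * ornsteinUhlenbeck f x‖ + ‖ornsteinUhlenbeck (χ n) x * f x‖ +
          ‖2 * ∑ i, partialDeriv i (χ n) x * partialDeriv i f x‖ :=
          (norm_sub_le _ _).trans (add_le_add_left (norm_add_le _ _) _)
      _ ≤ M + K * M + 2 * (d * (K * M)) := by
        rw [norm_mul (2 : ℂ), Complex.norm_two]
        gcongr
      _ = _ := by ring
  have hm0n : ∀ n, MemLp (fun x => χ n x * f x) 2 (gaussianMeasure d 1) := fun n =>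
    memLp_gaussianMeasure_of_le (hχf n).continuous.aestronglyMeasurable (hb0 n)
  have hm2n : ∀ n, MemLp (ornsteinUhlenbeck fun x => χ n x * f x) 2 (gaussianMeasure d 1) :=
    fun n => memLp_gaussianMeasure_of_le
      (continuous_ornsteinUhlenbeck (hχf n)).aestronglyMeasurable (hb2 n)
  have hbound : ∀ C' : ℝ, MemLp (fun x : EuclideanSpace ℝ (Fin d) => C' * Real.exp (c * ‖x‖)) 2
      (gaussianMeasure d 1) := by
    intro C'
    have h := memLp_gaussianMeasure_of_le (d := d) (C := |C'|) (c := c)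
      (f := fun x => ((C' * Real.exp (c * ‖x‖) : ℝ) : ℂ)) (by fun_prop) fun x => by
        rw [Complex.norm_real, norm_mul, Real.norm_of_nonneg (Real.exp_pos _).le, Real.norm_eq_abs]
    exact h.re
  have heq : ∀ x, ∀ᶠ n in atTop, (fun x => χ n x * f x) =ᶠ[𝓝 x] f := fun x => by
    filter_upwards [hlim x] with n hn
    filter_upwards [hn] with y hy
    rw [hy, Pi.one_apply, one_mul]
  have ht0 := tendsto_toLp_two_of_dominated hm0n hm (hbound C) hb0 fun x =>
    tendsto_const_nhds.congr' (by filter_upwards [heq x] with n hn using hn.eq_of_nhds.symm)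
  have ht2 := tendsto_toLp_two_of_dominated hm2n hm' (hbound _) hb2 fun x =>
    tendsto_const_nhds.congr' (by
      filter_upwards [heq x] with n hn using (ornsteinUhlenbeck_congr hn).symm)
  refine mem_closure_of_tendsto (ht0.prodMk_nhds ht2) (Eventually.of_forall fun n => ?_)
  exact ⟨_, hχf n, (hχs n).mul_right, (hm0n n).coeFn_toLp, (hm2n n).coeFn_toLp⟩

end Cutoff

/-! ### Ridge functions and their powers -/

section Ridge

variable {d : ℕ}

theorem hasFDerivAt_ridge {h : ℝ → ℂ} {h' : ℂ} (ξ x : EuclideanSpace ℝ (Fin d))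
    (hh : HasDerivAt h h' (inner ℝ ξ x)) :
    HasFDerivAt (fun x => h (inner ℝ ξ x)) ((innerSL ℝ ξ).smulRight h') x := by
  have h1 := hh.hasFDerivAt.comp x (innerSL ℝ ξ).hasFDerivAt
  refine h1.congr_fderiv ?_
  ext v
  simp

theorem partialDeriv_ridge {h h' : ℝ → ℂ} (hh : ∀ t, HasDerivAt h (h' t) t)
    (ξ : EuclideanSpace ℝ (Fin d)) (i : Fin d) :
    partialDeriv i (fun x => h (inner ℝ ξ x)) = fun x => (ξ i : ℂ) * h' (inner ℝ ξ x) := by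
  funext x
  rw [partialDeriv, (hasFDerivAt_ridge ξ x (hh _)).fderiv]
  simp [EuclideanSpace.inner_single_right]

theorem ornsteinUhlenbeck_ridge {h h' h'' : ℝ → ℂ} (hc : ContDiff ℝ 2 h)
    (hh : ∀ t, HasDerivAt h (h' t) t) (hh' : ∀ t, HasDerivAt h' (h'' t) t)
    (ξ x : EuclideanSpace ℝ (Fin d)) :
    ornsteinUhlenbeck (fun x => h (inner ℝ ξ x)) x =
      (inner ℝ ξ x : ℝ) * h' (inner ℝ ξ x) - (‖ξ‖ : ℂ) ^ 2 * h'' (inner ℝ ξ x) := by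
  have hf : ContDiff ℝ 2 fun x => h (inner ℝ ξ x) := hc.comp (innerSL ℝ ξ).contDiff
  have h2 : ∀ i, partialDeriv i (partialDeriv i fun x => h (inner ℝ ξ x)) x =
      (ξ i : ℂ) ^ 2 * h'' (inner ℝ ξ x) := by
    intro i
    rw [partialDeriv_ridge hh, partialDeriv_ridge (h := fun t => (ξ i : ℂ) * h' t)
      (fun t => (hh' t).const_mul _)]
    ring
  have e1 : (‖ξ‖ : ℂ) ^ 2 = ∑ i, (ξ i : ℂ) ^ 2 := by
    rw [← Complex.ofReal_pow, EuclideanSpace.real_norm_sq_eq]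
    push_cast
    rfl
  have e2 : ((inner ℝ ξ x : ℝ) : ℂ) = ∑ i, (ξ i : ℂ) * x i := by
    rw [PiLp.inner_apply]
    push_cast
    exact Finset.sum_congr rfl fun i _ => by simp [mul_comm]
  rw [ornsteinUhlenbeck_eq_sum hf]
  simp_rw [h2, partialDeriv_ridge hh]
  rw [Finset.sum_add_distrib, Finset.sum_neg_distrib, ← Finset.sum_mul, ← e1, e2, Finset.sum_mul]
  have e3 : ∀ i, (x i : ℂ) * ((ξ i : ℂ) * h' (inner ℝ ξ x)) = ξ i * x i * h' (inner ℝ ξ x) :=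
    fun i => by ring
  simp_rw [e3]
  ring

theorem memLp_ridge {h : ℝ → ℂ} (hc : Continuous h) {C c : ℝ} (hc0 : 0 ≤ c)
    (hb : ∀ t, ‖h t‖ ≤ C * Real.exp (c * |t|)) (ξ : EuclideanSpace ℝ (Fin d)) :
    MemLp (fun x => h (inner ℝ ξ x)) 2 (gaussianMeasure d 1) := by
  have hC : 0 ≤ C := by simpa using (norm_nonneg _).trans (hb 0)
  refine memLp_gaussianMeasure_of_le (C := C) (c := c * ‖ξ‖)
    (hc.comp (continuous_const.inner continuous_id)).aestronglyMeasurable fun x => ?_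
  refine (hb _).trans ?_
  rw [mul_assoc c]
  gcongr
  exact abs_real_inner_le_norm ξ x

/-- Ridge functions `x ↦ h ⟨ξ, x⟩` with exponentially bounded profile lie in the domain of the
Ornstein-Uhlenbeck operator. -/
theorem mem_ouGraph_ridge {h h' h'' : ℝ → ℂ} (hc : ContDiff ℝ 2 h)
    (hh : ∀ t, HasDerivAt h (h' t) t) (hh' : ∀ t, HasDerivAt h' (h'' t) t)
    {C c : ℝ} (hc0 : 0 ≤ c) (hb : ∀ t, ‖h t‖ ≤ C * Real.exp (c * |t|))
    (hb' : ∀ t, ‖h' t‖ ≤ C * Real.exp (c * |t|)) (hb'' : ∀ t, ‖h'' t‖ ≤ C * Real.exp (c * |t|))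
    (ξ : EuclideanSpace ℝ (Fin d)) {u v : GaussL2 d}
    (hu : u =ᵐ[gaussianMeasure d 1] fun x => h (inner ℝ ξ x))
    (hv : v =ᵐ[gaussianMeasure d 1] fun x =>
      (inner ℝ ξ x : ℝ) * h' (inner ℝ ξ x) - (‖ξ‖ : ℂ) ^ 2 * h'' (inner ℝ ξ x)) :
    (u, v) ∈ ouGraph d := by
  have hC : 0 ≤ C := by simpa using (norm_nonneg _).trans (hb 0)
  have hf : ContDiff ℝ 2 fun x => h (inner ℝ ξ x) := hc.comp (innerSL ℝ ξ).contDiff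
  have hL : ornsteinUhlenbeck (fun x => h (inner ℝ ξ x)) = fun x =>
      (inner ℝ ξ x : ℝ) * h' (inner ℝ ξ x) - (‖ξ‖ : ℂ) ^ 2 * h'' (inner ℝ ξ x) :=
    funext fun x => ornsteinUhlenbeck_ridge hc hh hh' ξ x
  set M := 1 + ‖ξ‖ + ‖ξ‖ ^ 2 with hM
  have hM1 : 1 ≤ M := by rw [hM]; nlinarith [norm_nonneg ξ]
  have hexp : ∀ x, Real.exp (c * |inner ℝ ξ x|) ≤ Real.exp ((c + 1) * ‖ξ‖ * ‖x‖) := fun x => by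
    have h1 := abs_real_inner_le_norm ξ x
    rw [Real.exp_le_exp, mul_assoc]
    exact mul_le_mul (by linarith) h1 (abs_nonneg _) (by linarith)
  -- The unbounded drift coefficient is paid for by raising the exponential rate from `c` to `c +
  -- 1`.
  have hexp1 : ∀ x, |inner ℝ ξ x| * Real.exp (c * |inner ℝ ξ x|) ≤
      Real.exp ((c + 1) * ‖ξ‖ * ‖x‖) := fun x => by
    have h1 := abs_real_inner_le_norm ξ x
    calc _ ≤ Real.exp |inner ℝ ξ x| * Real.exp (c * |inner ℝ ξ x|) := by
          gcongr
          linarith [Real.add_one_le_exp |inner ℝ ξ x|]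
      _ = Real.exp ((c + 1) * |inner ℝ ξ x|) := by rw [← Real.exp_add]; ring_nf
      _ ≤ _ := by
          rw [Real.exp_le_exp, mul_assoc]
          gcongr
  have b0 : ∀ x, ‖h (inner ℝ ξ x)‖ ≤ (C * M) * Real.exp ((c + 1) * ‖ξ‖ * ‖x‖) := fun x => by
    refine (hb _).trans ?_
    exact mul_le_mul (le_mul_of_one_le_right hC hM1) (hexp x) (Real.exp_pos _).le (by positivity)
  have b1 : ∀ x, ‖fderiv ℝ (fun x => h (inner ℝ ξ x)) x‖ ≤
      (C * M) * Real.exp ((c + 1) * ‖ξ‖ * ‖x‖) := fun x => by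
    rw [(hasFDerivAt_ridge ξ x (hh _)).fderiv, ContinuousLinearMap.norm_smulRight_apply,
      innerSL_apply_norm]
    calc _ ≤ M * (C * Real.exp ((c + 1) * ‖ξ‖ * ‖x‖)) := by
          refine mul_le_mul ?_ ((hb' _).trans ?_) (norm_nonneg _) (by positivity)
          · rw [hM]; nlinarith [norm_nonneg ξ]
          · exact mul_le_mul_of_nonneg_left (hexp x) hC
      _ = _ := by ring
  have b2 : ∀ x, ‖ornsteinUhlenbeck (fun x => h (inner ℝ ξ x)) x‖ ≤
      (C * M) * Real.exp ((c + 1) * ‖ξ‖ * ‖x‖) := fun x => by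
    rw [hL]
    refine (norm_sub_le _ _).trans ?_
    rw [norm_mul, norm_mul, norm_pow, Complex.norm_real, Complex.norm_real, norm_norm,
      Real.norm_eq_abs]
    have e1 : |inner ℝ ξ x| * ‖h' (inner ℝ ξ x)‖ ≤ C * Real.exp ((c + 1) * ‖ξ‖ * ‖x‖) := by
      calc _ ≤ |inner ℝ ξ x| * (C * Real.exp (c * |inner ℝ ξ x|)) := by gcongr; exact hb' _
        _ = C * (|inner ℝ ξ x| * Real.exp (c * |inner ℝ ξ x|)) := by ring
        _ ≤ _ := by gcongr; exact hexp1 x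
    have e2 : ‖ξ‖ ^ 2 * ‖h'' (inner ℝ ξ x)‖ ≤
        ‖ξ‖ ^ 2 * (C * Real.exp ((c + 1) * ‖ξ‖ * ‖x‖)) := by
      gcongr
      exact (hb'' _).trans (mul_le_mul_of_nonneg_left (hexp x) hC)
    have e3 : 0 ≤ ‖ξ‖ * (C * Real.exp ((c + 1) * ‖ξ‖ * ‖x‖)) := by positivity
    rw [hM]
    nlinarith
  have hm := memLp_gaussianMeasure_of_le hf.continuous.aestronglyMeasurable b0
  have hm' := memLp_gaussianMeasure_of_le
    (continuous_ornsteinUhlenbeck hf).aestronglyMeasurable b2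
  have key := mem_ouGraph_of_le_exp hf b0 b1 b2 hm hm'
  have e1 : u = hm.toLp _ := Lp.ext (hu.trans hm.coeFn_toLp.symm)
  have e2 : v = hm'.toLp _ := by
    refine Lp.ext (hv.trans ?_)
    rw [← hL]
    exact hm'.coeFn_toLp.symm
  rw [e1, e2]
  exact key

theorem abs_pow_le_factorial_mul_exp (t : ℝ) (n : ℕ) :
    |t| ^ n ≤ n.factorial * Real.exp |t| := by
  have h := Real.pow_div_factorial_le_exp |t| (abs_nonneg t) n
  rwa [div_le_iff₀ (by positivity), mul_comm] at h

theorem memLp_ridge_pow (ξ : EuclideanSpace ℝ (Fin d)) (n : ℕ) :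
    MemLp (fun x => ((inner ℝ ξ x : ℝ) : ℂ) ^ n) 2 (gaussianMeasure d 1) := by
  refine memLp_ridge (h := fun t => (t : ℂ) ^ n) (by fun_prop) (C := n.factorial) zero_le_one
    (fun t => ?_) ξ
  rw [norm_pow, Complex.norm_real, one_mul]
  exact abs_pow_le_factorial_mul_exp t n

/-- The power `⟨ξ, x⟩ ^ n` as an element of `L²(γ)`. -/
noncomputable def ridgePow (ξ : EuclideanSpace ℝ (Fin d)) (n : ℕ) : GaussL2 d :=
  (memLp_ridge_pow ξ n).toLp _

/-- Apply the ridge formula to `t ^ n`. The truncated subtraction is harmless: for `n < 2` the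
coefficient of the lower power vanishes. -/
theorem ridgePow_mem_ouGraph (ξ : EuclideanSpace ℝ (Fin d)) (n : ℕ) :
    (ridgePow ξ n, (n : ℂ) • ridgePow ξ n -
      ((n : ℂ) * (n - 1 : ℕ) * (‖ξ‖ : ℂ) ^ 2) • ridgePow ξ (n - 2)) ∈ ouGraph d := by
  have hd : ∀ (n : ℕ) (t : ℝ), HasDerivAt (fun t : ℝ => (t : ℂ) ^ n) (n * (t : ℂ) ^ (n - 1)) t := by
    intro n t
    have h := (Complex.ofRealCLM.hasDerivAt (x := t)).fun_pow n
    simpa using h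
  have hle : ∀ (m : ℕ), m ≤ n → ∀ t : ℝ, |t| ^ m ≤ n.factorial * Real.exp (1 * |t|) := by
    intro m hm t
    rw [one_mul]
    refine (abs_pow_le_factorial_mul_exp t m).trans ?_
    gcongr
  refine mem_ouGraph_ridge (h := fun t => (t : ℂ) ^ n) (h' := fun t => (n : ℂ) * (t : ℂ) ^ (n - 1))
    (h'' := fun t => (n : ℂ) * ((n - 1 : ℕ) * (t : ℂ) ^ (n - 1 - 1)))
    (C := (n : ℝ) ^ 2 * n.factorial + n * n.factorial + n.factorial) (c := 1)
    (Complex.ofRealCLM.contDiff.pow n) (hd n) (fun t => (hd (n - 1) t).const_mul _) zero_le_one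
    (fun t => ?_) (fun t => ?_) (fun t => ?_) ξ (MemLp.coeFn_toLp _) ?_
  · rw [norm_pow, Complex.norm_real]
    refine (hle n le_rfl t).trans ?_
    gcongr
    have : (0 : ℝ) ≤ (n : ℝ) ^ 2 * n.factorial + n * n.factorial := by positivity
    linarith
  · rw [norm_mul, norm_pow, Complex.norm_real, Complex.norm_natCast]
    calc _ ≤ (n : ℝ) * (n.factorial * Real.exp (1 * |t|)) := by
          gcongr; exact hle _ (Nat.sub_le _ _) t
      _ = (n * n.factorial) * Real.exp (1 * |t|) := by ring
      _ ≤ _ := by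
        gcongr
        have h1 : (0 : ℝ) ≤ (n : ℝ) ^ 2 * n.factorial := by positivity
        have h2 : (0 : ℝ) ≤ n.factorial := by positivity
        linarith
  · rw [norm_mul, norm_mul, norm_pow, Complex.norm_real, Complex.norm_natCast,
      Complex.norm_natCast]
    calc _ ≤ (n : ℝ) * (n * (n.factorial * Real.exp (1 * |t|))) := by
          gcongr
          · exact Nat.sub_le _ _
          · exact hle _ (by omega) t
      _ = (n ^ 2 * n.factorial) * Real.exp (1 * |t|) := by ring
      _ ≤ _ := by
        gcongr
        have h1 : (0 : ℝ) ≤ n * n.factorial := by positivity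
        have h2 : (0 : ℝ) ≤ n.factorial := by positivity
        linarith
  · filter_upwards [Lp.coeFn_sub ((n : ℂ) • ridgePow ξ n)
      (((n : ℂ) * (n - 1 : ℕ) * (‖ξ‖ : ℂ) ^ 2) • ridgePow ξ (n - 2)),
      Lp.coeFn_smul (n : ℂ) (ridgePow ξ n),
      Lp.coeFn_smul ((n : ℂ) * (n - 1 : ℕ) * (‖ξ‖ : ℂ) ^ 2) (ridgePow ξ (n - 2)),
      (memLp_ridge_pow ξ n).coeFn_toLp, (memLp_ridge_pow ξ (n - 2)).coeFn_toLp]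
      with x h1 h2 h3 h4 h5
    rw [h1, Pi.sub_apply, h2, h3, Pi.smul_apply, Pi.smul_apply, ridgePow, ridgePow, h4, h5]
    rcases n with _ | n
    · simp
    · simp only [smul_eq_mul, Nat.add_sub_cancel, Nat.reduceSubDiff]
      ring

end Ridge

/-! ### Eigenspaces and the triangular action on powers -/

section Eigenspaces

variable {d : ℕ}

/-- The eigenspace of the Ornstein-Uhlenbeck operator for the eigenvalue `n`. -/
noncomputable def ouEigenspace (d n : ℕ) : Submodule ℂ (GaussL2 d) :=
  (ouSubmodule d).comap (LinearMap.prod LinearMap.id ((n : ℂ) • LinearMap.id))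

theorem mem_ouEigenspace {n : ℕ} {u : GaussL2 d} :
    u ∈ ouEigenspace d n ↔ (u, (n : ℂ) • u) ∈ ouSubmodule d := Iff.rfl

theorem orthogonalFamily_ouEigenspace (d : ℕ) :
    OrthogonalFamily ℂ (fun n => ouEigenspace d n) fun n => (ouEigenspace d n).subtypeₗᵢ := by
  intro i j hij u v
  have h := inner_ouGraph_comm (mem_ouEigenspace.1 u.2) (mem_ouEigenspace.1 v.2)
  simp only [inner_smul_left, inner_smul_right, map_natCast] at h
  have h1 : ((j : ℂ) - i) * inner ℂ (u : GaussL2 d) (v : GaussL2 d) = 0 := by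
    rw [sub_mul, h, sub_self]
  rcases mul_eq_zero.1 h1 with h2 | h2
  · exact absurd (by exact_mod_cast (sub_eq_zero.1 h2).symm) hij
  · exact h2

/-- `L - n` acts on the `k`-th eigenspace as `k - n`, which is nonzero for `k < n`, so it can be
inverted there. -/
theorem exists_ou_sub_smul_eq {n : ℕ} {u : GaussL2 d} (hu : u ∈ ⨆ k : Fin n, ouEigenspace d k) :
    ∃ q ∈ ⨆ k : Fin n, ouEigenspace d k, (q, u + (n : ℂ) • q) ∈ ouSubmodule d := by
  induction hu using Submodule.iSup_induction' with
  | mem k u hu =>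
    have hk : ((k : ℕ) : ℂ) - n ≠ 0 := by
      rw [sub_ne_zero]
      exact_mod_cast k.2.ne
    refine ⟨(((k : ℕ) : ℂ) - n)⁻¹ • u, Submodule.smul_mem _ _ (Submodule.mem_iSup_of_mem k hu), ?_⟩
    have h := (ouSubmodule d).smul_mem (((k : ℕ) : ℂ) - n)⁻¹ (mem_ouEigenspace.1 hu)
    have e : u + (n : ℂ) • ((((k : ℕ) : ℂ) - n)⁻¹ • u) =
        (((k : ℕ) : ℂ) - n)⁻¹ • (((k : ℕ) : ℂ) • u) := by
      rw [smul_smul, smul_smul]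
      nth_rewrite 1 [← one_smul ℂ u]
      rw [← add_smul]
      congr 1
      field_simp
      ring
    rw [e]
    exact h
  | zero =>
    refine ⟨0, Submodule.zero_mem _, ?_⟩
    rw [smul_zero, add_zero]
    exact (ouSubmodule d).zero_mem
  | add u v _ _ hu hv =>
    obtain ⟨q, hq, hq'⟩ := hu
    obtain ⟨r, hr, hr'⟩ := hv
    refine ⟨q + r, Submodule.add_mem _ hq hr, ?_⟩
    have h := (ouSubmodule d).add_mem hq' hr'
    rw [Prod.mk_add_mk] at h
    rwa [smul_add, add_add_add_comm]

theorem iSup_ouEigenspace_mono {m n : ℕ} (h : m ≤ n) :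
    ⨆ k : Fin m, ouEigenspace d k ≤ ⨆ k : Fin n, ouEigenspace d k :=
  iSup_le fun k => le_iSup (fun k : Fin n => ouEigenspace d k) (Fin.castLE h k)

/-- By strong induction `(L - n) ⟨ξ, x⟩ ^ n = -r` with `r` in the lower eigenspaces. Solving `(L -
n) q = -r` there, the difference of the power and `q` is an eigenvector for `n`. -/
theorem ridgePow_mem_iSup (ξ : EuclideanSpace ℝ (Fin d)) (n : ℕ) :
    ridgePow ξ n ∈ ⨆ k : Fin (n + 1), ouEigenspace d k := by
  induction n using Nat.strong_induction_on with
  | _ n ih =>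
    set r := ((n : ℂ) * (n - 1 : ℕ) * (‖ξ‖ : ℂ) ^ 2) • ridgePow ξ (n - 2) with hr
    have hrm : r ∈ ⨆ k : Fin n, ouEigenspace d k := by
      rcases Nat.lt_or_ge n 2 with h | h
      · have : r = 0 := by
          rw [hr]
          interval_cases n <;> simp
        rw [this]
        exact Submodule.zero_mem _
      · refine Submodule.smul_mem _ _ (iSup_ouEigenspace_mono ?_ (ih (n - 2) (by omega)))
        omega
    obtain ⟨q, hq, hq'⟩ := exists_ou_sub_smul_eq (Submodule.neg_mem _ hrm)
    have h1 : ridgePow ξ n - q ∈ ouEigenspace d n := by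
      rw [mem_ouEigenspace]
      have h := (ouSubmodule d).sub_mem (mem_ouSubmodule.2 (ridgePow_mem_ouGraph ξ n)) hq'
      rw [Prod.mk_sub_mk, ← hr] at h
      have e : (n : ℂ) • ridgePow ξ n - r - (-r + (n : ℂ) • q) = (n : ℂ) • (ridgePow ξ n - q) := by
        rw [smul_sub]
        abel
      rwa [e] at h
    have h2 : ridgePow ξ n = (ridgePow ξ n - q) + q := by abel
    rw [h2]
    refine Submodule.add_mem _ ?_ (iSup_ouEigenspace_mono (Nat.le_succ n) hq)
    exact Submodule.mem_iSup_of_mem (Fin.last n) h1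

end Eigenspaces

/-! ### Totality of the eigenspaces by Fourier injectivity -/

section Totality

/-- Every test function is the Fourier transform of a Schwartz function `η`; moving the transform
from `η` to `g` shows that `g` integrates to zero against it. -/
theorem ae_eq_zero_of_fourier_eq_zero {V : Type*} [NormedAddCommGroup V] [InnerProductSpace ℝ V]
    [FiniteDimensional ℝ V] [MeasurableSpace V] [BorelSpace V] {g : V → ℂ} (hg : Integrable g)
    (h : ∀ w, FourierTransform.fourier g w = 0) : g =ᵐ[volume] 0 := by
  refine ae_eq_zero_of_integral_contDiff_smul_eq_zero hg.locallyIntegrable fun ψ hψ hψs => ?_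
  have hψ' : ContDiff ℝ ((⊤ : ℕ∞) : WithTop ℕ∞) fun x => (ψ x : ℂ) :=
    Complex.ofRealCLM.contDiff.comp hψ
  have hψs' : HasCompactSupport fun x => (ψ x : ℂ) :=
    hψs.comp_left (g := fun r : ℝ => (r : ℂ)) rfl
  let Ψ : SchwartzMap V ℂ := hψs'.toSchwartzMap hψ'
  let η : SchwartzMap V ℂ := FourierTransformInv.fourierInv Ψ
  have hη : FourierTransform.fourier (η : V → ℂ) = fun x => (ψ x : ℂ) := by
    rw [← SchwartzMap.fourier_coe, FourierTransform.fourier_fourierInv_eq]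
    rfl
  have key := VectorFourier.integral_fourierIntegral_smul_eq_flip (L := innerₗ V)
    (μ := volume) (ν := volume) Real.continuous_fourierChar continuous_inner η.integrable hg
  have e1 : VectorFourier.fourierIntegral Real.fourierChar volume (innerₗ V) (η : V → ℂ) =
      fun x => (ψ x : ℂ) := hη
  have e2 : VectorFourier.fourierIntegral Real.fourierChar volume (innerₗ V).flip g = 0 := by
    rw [flip_innerₗ]
    exact funext h
  rw [e1, e2] at key
  simpa using key

variable {d : ℕ}

theorem norm_exp_profile_le (a b : ℂ) (t : ℝ) :
    ‖Complex.exp (a * t - b)‖ ≤ ‖Complex.exp (-b)‖ * Real.exp (‖a‖ * |t|) := by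
  rw [sub_eq_add_neg, Complex.exp_add, norm_mul, mul_comm]
  gcongr
  rw [Complex.norm_exp, Real.exp_le_exp]
  refine (Complex.re_le_norm _).trans ?_
  rw [norm_mul, Complex.norm_real, Real.norm_eq_abs]

theorem memLp_exp_ridge (a : ℂ) (ξ : EuclideanSpace ℝ (Fin d)) :
    MemLp (fun x => Complex.exp (a * (inner ℝ ξ x : ℝ) - a ^ 2 * ‖ξ‖ ^ 2 / 2)) 2
      (gaussianMeasure d 1) :=
  memLp_ridge (h := fun t : ℝ => Complex.exp (a * t - a ^ 2 * ‖ξ‖ ^ 2 / 2)) (by fun_prop)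
    (norm_nonneg a) (norm_exp_profile_le a _) ξ

/-- The normalised exponential `exp (a ⟨ξ, x⟩ - a² |ξ|² / 2)` as an element of `L²(γ)`. -/
noncomputable def expVec (a : ℂ) (ξ : EuclideanSpace ℝ (Fin d)) : GaussL2 d :=
  (memLp_exp_ridge a ξ).toLp _

theorem coeFn_expVec (a : ℂ) (ξ : EuclideanSpace ℝ (Fin d)) :
    expVec a ξ =ᵐ[gaussianMeasure d 1] fun x =>
      Complex.exp (a * (inner ℝ ξ x : ℝ) - a ^ 2 * ‖ξ‖ ^ 2 / 2) :=
  (memLp_exp_ridge a ξ).coeFn_toLp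

/-- At `a = i` the pairing is, up to a nonzero constant and a rescaling of the frequency, the
Fourier transform of the conjugate of `u` times the Gaussian density. -/
theorem eq_zero_of_inner_expVec_eq_zero {u : GaussL2 d}
    (h : ∀ ξ, inner ℂ u (expVec Complex.I ξ) = 0) : u = 0 := by
  have hu : Integrable (fun x => star (u x)) (gaussianMeasure d 1) := by
    have h1 := (Lp.memLp u).integrable (by norm_num)
    exact (starL' ℝ (A := ℂ)).toContinuousLinearMap.integrable_comp h1
  rw [integrable_gaussianMeasure_iff one_pos] at hu
  have hint : ∀ ξ : EuclideanSpace ℝ (Fin d), ∫ x, Complex.exp (Complex.I * (inner ℝ ξ x : ℝ)) *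
      (gaussianDensity d 1 x • star (u x)) = 0 := by
    intro ξ
    have h1 := h ξ
    rw [L2.inner_def] at h1
    have h2 : ∫ x, inner ℂ (u x) (expVec Complex.I ξ x) ∂gaussianMeasure d 1 =
        ∫ x, Complex.exp (Complex.I * (inner ℝ ξ x : ℝ)) * star (u x) *
          Complex.exp (‖ξ‖ ^ 2 / 2) ∂gaussianMeasure d 1 := by
      refine integral_congr_ae ?_
      filter_upwards [coeFn_expVec Complex.I ξ] with x hx
      rw [hx, RCLike.inner_apply, Complex.I_sq, neg_one_mul, neg_div, sub_neg_eq_add,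
        Complex.exp_add]
      simp only [RCLike.star_def]
      ring
    rw [h2, integral_mul_const] at h1
    have h3 := (mul_eq_zero.1 h1).resolve_right (Complex.exp_ne_zero _)
    rw [integral_gaussianMeasure one_pos] at h3
    rw [← h3]
    refine integral_congr_ae (Eventually.of_forall fun x => ?_)
    simp only [Complex.real_smul]
    ring
  have h0 : (fun x => gaussianDensity d 1 x • star (u x)) =ᵐ[volume] 0 := by
    refine ae_eq_zero_of_fourier_eq_zero hu fun w => ?_
    rw [Real.fourier_eq']
    rw [← hint ((-2 * Real.pi) • w)]
    refine integral_congr_ae (Eventually.of_forall fun x => ?_)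
    simp only [smul_eq_mul, inner_smul_left, real_inner_comm w x]
    congr 2
    simp
    ring
  refine Lp.ext ?_
  filter_upwards [gaussianMeasure_absolutelyContinuous d 1 h0, Lp.coeFn_zero ℂ 2
    (gaussianMeasure d 1)] with x hx hx0
  rw [hx0]
  have h1 := (smul_eq_zero.1 hx).resolve_left (gaussianDensity_pos d one_pos x).ne'
  simpa using h1

/-- The Taylor sums of the exponential are combinations of the powers and converge in `L²`,
dominated by a multiple of `exp |⟨ξ, x⟩|`. -/
theorem inner_expVec_eq_zero_of_inner_ridgePow {u : GaussL2 d} {ξ : EuclideanSpace ℝ (Fin d)}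
    (h : ∀ n, inner ℂ u (ridgePow ξ n) = 0) : inner ℂ u (expVec Complex.I ξ) = 0 := by
  set K : ℂ := Complex.exp (-(Complex.I ^ 2 * ‖ξ‖ ^ 2 / 2)) with hK
  let F : ℕ → EuclideanSpace ℝ (Fin d) → ℂ := fun n x =>
    ∑ k ∈ Finset.range n, (K * (Complex.I ^ k / k.factorial)) * ((inner ℝ ξ x : ℝ) : ℂ) ^ k
  have hF : ∀ n, MemLp (F n) 2 (gaussianMeasure d 1) := fun n =>
    memLp_finsetSum _ fun k _ => (memLp_ridge_pow ξ k).const_mul _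
  have h0 : ∀ n, inner ℂ u ((hF n).toLp (F n)) = 0 := by
    intro n
    induction n with
    | zero =>
      have : (hF 0).toLp (F 0) = 0 := by
        refine Lp.ext ((hF 0).coeFn_toLp.trans ?_)
        filter_upwards [Lp.coeFn_zero ℂ 2 (gaussianMeasure d 1)] with x hx
        rw [hx]
        simp [F]
      rw [this, inner_zero_right]
    | succ n ih =>
      have : (hF (n + 1)).toLp (F (n + 1)) = (hF n).toLp (F n) +
          (K * (Complex.I ^ n / n.factorial)) • ridgePow ξ n := by
        rw [ridgePow, ← MemLp.toLp_const_smul, ← MemLp.toLp_add, MemLp.toLp_eq_toLp_iff]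
        refine Eventually.of_forall fun x => ?_
        simp only [F, Finset.sum_range_succ]
        rfl
      rw [this, inner_add_right, ih, inner_smul_right, h, mul_zero, add_zero]
  have hbound : MemLp (fun x : EuclideanSpace ℝ (Fin d) => ‖K‖ * Real.exp |inner ℝ ξ x|) 2
      (gaussianMeasure d 1) := by
    have h1 := memLp_ridge (h := fun t : ℝ => ((Real.exp |t| : ℝ) : ℂ)) (by fun_prop) (C := 1)
      (c := 1) zero_le_one (fun t => by
        rw [Complex.norm_real, Real.norm_of_nonneg (Real.exp_pos _).le]; simp) ξ
    exact h1.re.const_mul _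
  have hle : ∀ n x, ‖F n x‖ ≤ ‖K‖ * Real.exp |inner ℝ ξ x| := by
    intro n x
    refine (norm_sum_le _ _).trans ?_
    refine le_trans ?_ (mul_le_mul_of_nonneg_left
      (Real.sum_le_exp_of_nonneg (abs_nonneg (inner ℝ ξ x)) n) (norm_nonneg K))
    rw [Finset.mul_sum]
    refine Finset.sum_le_sum fun k _ => le_of_eq ?_
    rw [norm_mul, norm_mul, norm_div, norm_pow, norm_pow, Complex.norm_I, one_pow,
      Complex.norm_real, Complex.norm_natCast, Real.norm_eq_abs]
    ring
  have hlim : ∀ x, Tendsto (fun n => F n x) atTop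
      (𝓝 (Complex.exp (Complex.I * (inner ℝ ξ x : ℝ) - Complex.I ^ 2 * ‖ξ‖ ^ 2 / 2))) := by
    intro x
    have h1 := ((NormedSpace.expSeries_div_hasSum_exp
      (Complex.I * ((inner ℝ ξ x : ℝ) : ℂ))).mul_left K).tendsto_sum_nat
    rw [← Complex.exp_eq_exp_ℂ, hK, ← Complex.exp_add] at h1
    have e : -(Complex.I ^ 2 * ‖ξ‖ ^ 2 / 2) + Complex.I * ((inner ℝ ξ x : ℝ) : ℂ) =
        Complex.I * (inner ℝ ξ x : ℝ) - Complex.I ^ 2 * ‖ξ‖ ^ 2 / 2 := by ring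
    rw [e] at h1
    refine h1.congr fun n => Finset.sum_congr rfl fun k _ => ?_
    rw [mul_pow]
    ring
  have ht := tendsto_toLp_two_of_dominated hF (memLp_exp_ridge Complex.I ξ) hbound hle hlim
  have h2 := (Continuous.tendsto (f := fun v : GaussL2 d => inner ℂ u v) (by fun_prop) _).comp ht
  refine tendsto_nhds_unique h2 ?_
  simp only [Function.comp_def, h0]
  exact tendsto_const_nhds

theorem eq_zero_of_forall_inner_ouEigenspace {u : GaussL2 d}
    (h : ∀ n, ∀ v ∈ ouEigenspace d n, inner ℂ u v = 0) : u = 0 := by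
  refine eq_zero_of_inner_expVec_eq_zero fun ξ => inner_expVec_eq_zero_of_inner_ridgePow fun n => ?_
  have h1 : (⨆ k : Fin (n + 1), ouEigenspace d k) ≤ (ℂ ∙ u)ᗮ := by
    refine iSup_le fun k v hv => ?_
    rw [Submodule.mem_orthogonal_singleton_iff_inner_right]
    exact h _ v hv
  exact Submodule.mem_orthogonal_singleton_iff_inner_right.1 (h1 (ridgePow_mem_iSup ξ n))

end Totality

/-! ### The eigenbasis and the spectral description of the graph -/

theorem isClosed_ouEigenspace (d n : ℕ) : IsClosed (ouEigenspace d n : Set (GaussL2 d)) := by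
  have h : Continuous fun u : GaussL2 d => (u, (n : ℂ) • u) := by fun_prop
  exact isClosed_closure.preimage h

/-- The Ornstein-Uhlenbeck operator has an orthonormal basis of eigenvectors. -/
theorem exists_hilbertBasis_ou (d : ℕ) : ∃ (ι : Type) (b : HilbertBasis ι ℂ (GaussL2 d))
    (N : ι → ℕ), ∀ i, b i ∈ ouEigenspace d (N i) := by
  have hc : ∀ n, CompleteSpace (ouEigenspace d n) := fun n =>
    (isClosed_ouEigenspace d n).completeSpace_coe
  choose w b _ using fun n => exists_hilbertBasis ℂ (ouEigenspace d n)
  have ho := (orthogonalFamily_ouEigenspace d).orthonormal_sigma_orthonormal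
    (v_family := fun n => b n) fun n => (b n).orthonormal
  refine ⟨Σ n, w n, HilbertBasis.mkOfOrthogonalEqBot ho ?_, Sigma.fst, fun i => ?_⟩
  · rw [Submodule.eq_bot_iff]
    intro u hu
    refine eq_zero_of_forall_inner_ouEigenspace fun n => ?_
    have h1 : ∀ i, inner ℂ u ((b n i : ouEigenspace d n) : GaussL2 d) = 0 := fun i =>
      (Submodule.mem_orthogonal' _ u).1 hu _ (Submodule.subset_span ⟨⟨n, i⟩, rfl⟩)
    intro v hv
    have h2 := (b n).hasSum_repr ⟨v, hv⟩
    have h3 := (h2.mapL (ouEigenspace d n).subtypeL).mapL (innerSL ℂ u)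
    simp only [map_smul, Submodule.subtypeL_apply, innerSL_apply_apply, smul_eq_mul, h1,
      mul_zero] at h3
    exact h3.unique hasSum_zero
  · rw [HilbertBasis.coe_mkOfOrthogonalEqBot]
    exact (b i.1 i.2).2

/-- This is essential self-adjointness. Symmetry against eigenvectors gives the coordinates;
conversely the finite partial sums of both expansions lie in the closed graph and converge jointly.
-/
theorem mem_ouGraph_iff {d : ℕ} {ι : Type*} (b : HilbertBasis ι ℂ (GaussL2 d)) {N : ι → ℕ}
    (hb : ∀ i, b i ∈ ouEigenspace d (N i)) (w : GaussL2 d × GaussL2 d) :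
    w ∈ ouGraph d ↔ ∀ i, inner ℂ (b i) w.2 = N i * inner ℂ (b i) w.1 := by
  constructor
  · intro hw i
    have h := inner_ouGraph_comm (mem_ouEigenspace.1 (hb i)) hw
    rw [h, inner_smul_left, map_natCast]
  · intro h
    have h1 := (b.hasSum_repr w.1).prodMk (b.hasSum_repr w.2)
    refine isClosed_closure.mem_of_tendsto (s := closure (ouCoreGraph d)) h1
      (Eventually.of_forall fun s => ?_)
    refine (ouSubmodule d).sum_mem fun i _ => ?_
    have e : (b.repr w.1 i • b i, b.repr w.2 i • b i) =
        b.repr w.1 i • ((b i, (N i : ℂ) • b i) : GaussL2 d × GaussL2 d) := by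
      rw [Prod.smul_mk, smul_smul, b.repr_apply_apply, b.repr_apply_apply, h i, mul_comm]
    rw [e]
    exact Submodule.smul_mem _ _ (hb i)

/-! ### Existence, uniqueness and the action on exponentials -/

section ExpNegOU

variable {d : ℕ}

theorem HilbertBasis.inner_apply_of_eigenvector {ι H : Type*} [NormedAddCommGroup H]
    [InnerProductSpace ℂ H] (b : HilbertBasis ι ℂ H) {T : H →L[ℂ] H} {m : ι → ℂ}
    (h : ∀ i, T (b i) = m i • b i) (u : H) (i : ι) :
    inner ℂ (b i) (T u) = m i * inner ℂ (b i) u := by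
  have h1 := ((b.hasSum_repr u).mapL T).mapL (innerSL ℂ (b i))
  have h2 : ∀ j, j ≠ i → innerSL ℂ (b i) (T (b.repr u j • b j)) = 0 := fun j hj => by
    rw [map_smul, h, innerSL_apply_apply, inner_smul_right, inner_smul_right,
      b.orthonormal.inner_eq_zero hj.symm, mul_zero, mul_zero]
  have h3 := h1.unique (hasSum_single i h2)
  rw [innerSL_apply_apply] at h3
  rw [h3, map_smul, h, innerSL_apply_apply, inner_smul_right, inner_smul_right,
    inner_self_eq_norm_sq_to_K, b.orthonormal.norm_eq_one, b.repr_apply_apply]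
  simp [mul_comm]

theorem ouGraph_neg_smul_eq {ι : Type*} (b : HilbertBasis ι ℂ (GaussL2 d)) {N : ι → ℕ}
    (hb : ∀ i, b i ∈ ouEigenspace d (N i)) {z : ℂ} (hz : z ≠ 0) :
    {w : GaussL2 d × GaussL2 d | ∃ v, (w.1, v) ∈ ouGraph d ∧ w.2 = -(z • v)} =
      {w | ∀ i, inner ℂ (b i) w.2 = -(z * N i) * inner ℂ (b i) w.1} := by
  ext w
  constructor
  · rintro ⟨v, hv, hw⟩ i
    have h := (mem_ouGraph_iff b hb _).1 hv i
    simp only at h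
    rw [hw, inner_neg_right, inner_smul_right, h]
    ring
  · intro h
    refine ⟨-(z⁻¹ • w.2), (mem_ouGraph_iff b hb _).2 fun i => ?_, ?_⟩
    · simp only
      rw [inner_neg_right, inner_smul_right, h i]
      field_simp
    · rw [smul_neg, smul_inv_smul₀ hz, neg_neg]

theorem IsExpNegOU.inner_apply {ι : Type*} (b : HilbertBasis ι ℂ (GaussL2 d)) {N : ι → ℕ}
    (hb : ∀ i, b i ∈ ouEigenspace d (N i)) {z : ℂ} {T : GaussL2 d →L[ℂ] GaussL2 d}
    (hT : IsExpNegOU d z T) (u : GaussL2 d) (i : ι) :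
    inner ℂ (b i) (T u) = Complex.exp (-(z * N i)) * inner ℂ (b i) u := by
  obtain ⟨S, hS, rfl⟩ := hT
  refine b.inner_apply_of_eigenvector (m := fun i => Complex.exp (-(z * N i))) (fun i => ?_) u i
  have h1 : (b i, (-(z * N i)) • b i) ∈ S.generatorGraph := by
    rw [hS]
    exact ⟨(N i : ℂ) • b i, mem_ouEigenspace.1 (hb i), by rw [smul_smul, neg_smul]⟩
  have h2 := S.apply_eigenvector h1 1
  rwa [NNReal.coe_one, Complex.ofReal_one, one_mul] at h2

theorem existsUnique_isExpNegOU (d : ℕ) {z : ℂ} (hz : 0 < z.re) :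
    ∃! T : GaussL2 d →L[ℂ] GaussL2 d, IsExpNegOU d z T := by
  obtain ⟨ι, b, N, hb⟩ := exists_hilbertBasis_ou d
  have hz0 : z ≠ 0 := fun h => by simp [h] at hz
  obtain ⟨S, _, hS⟩ := b.exists_c0Semigroup (c := fun i => -(z * N i)) fun i => by
    have h : 0 ≤ z.re * N i := mul_nonneg hz.le (Nat.cast_nonneg _)
    simpa using h
  have hex : IsExpNegOU d z (S.toFun 1) := ⟨S, by rw [hS, ouGraph_neg_smul_eq b hb hz0], rfl⟩
  refine ⟨S.toFun 1, hex, fun T hT => ?_⟩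
  ext1 u
  exact b.ext_inner fun i => by rw [hT.inner_apply b hb, hex.inner_apply b hb]

theorem norm_exp_profile_le_of_norm_le {a : ℂ} {R : ℝ} (ha : ‖a‖ ≤ R) (s t : ℝ) :
    ‖Complex.exp (a * t - a ^ 2 * s ^ 2 / 2)‖ ≤ Real.exp (R ^ 2 * s ^ 2 / 2) *
      Real.exp (R * |t|) := by
  refine (norm_exp_profile_le a _ t).trans ?_
  gcongr
  rw [Complex.norm_exp, Real.exp_le_exp]
  refine (Complex.re_le_norm _).trans ?_
  rw [norm_neg, norm_div, norm_mul, norm_pow, norm_pow, Complex.norm_real, Complex.norm_two,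
    Real.norm_eq_abs, sq_abs]
  gcongr

/-- Differentiation under the integral in the complex parameter; on the unit ball around `a` all
integrands are dominated with `R = ‖a‖ + 1`. -/
theorem hasDerivAt_inner_expVec (u : GaussL2 d) (a : ℂ) (ξ : EuclideanSpace ℝ (Fin d)) :
    HasDerivAt (fun a => inner ℂ u (expVec a ξ))
      (∫ x, star (u x) * (((inner ℝ ξ x : ℝ) - a * ‖ξ‖ ^ 2) *
        Complex.exp (a * (inner ℝ ξ x : ℝ) - a ^ 2 * ‖ξ‖ ^ 2 / 2)) ∂gaussianMeasure d 1) a := by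
  have h1 : (fun a => inner ℂ u (expVec a ξ)) = fun a => ∫ x, star (u x) *
      Complex.exp (a * (inner ℝ ξ x : ℝ) - a ^ 2 * ‖ξ‖ ^ 2 / 2) ∂gaussianMeasure d 1 := by
    funext a
    rw [L2.inner_def]
    refine integral_congr_ae ?_
    filter_upwards [coeFn_expVec a ξ] with x hx
    rw [hx, RCLike.inner_apply, mul_comm]
    rfl
  rw [h1]
  set R := ‖a‖ + 1 with hR
  have hR0 : 0 ≤ R := by positivity
  set C := (1 + R * ‖ξ‖ ^ 2) * Real.exp (R ^ 2 * ‖ξ‖ ^ 2 / 2) with hC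
  have hu : AEStronglyMeasurable (fun x => star (u x)) (gaussianMeasure d 1) :=
    (Lp.aestronglyMeasurable u).star
  have hum : MemLp (fun x => star (u x)) 2 (gaussianMeasure d 1) := (Lp.memLp u).star
  have hbm : MemLp (fun x : EuclideanSpace ℝ (Fin d) =>
      C * Real.exp ((R + 1) * |inner ℝ ξ x|)) 2 (gaussianMeasure d 1) := by
    have h2 := memLp_ridge (h := fun t : ℝ => ((C * Real.exp ((R + 1) * |t|) : ℝ) : ℂ))
      (by fun_prop) (C := C) (c := R + 1) (by positivity) (fun t => by
        rw [Complex.norm_real, Real.norm_of_nonneg (by positivity)]) ξ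
    exact h2.re
  have hcont : ∀ a : ℂ, Continuous fun x : EuclideanSpace ℝ (Fin d) =>
      Complex.exp (a * (inner ℝ ξ x : ℝ) - a ^ 2 * ‖ξ‖ ^ 2 / 2) := fun a => by fun_prop
  have hFm : ∀ a : ℂ, AEStronglyMeasurable (fun x => star (u x) *
      Complex.exp (a * (inner ℝ ξ x : ℝ) - a ^ 2 * ‖ξ‖ ^ 2 / 2)) (gaussianMeasure d 1) :=
    fun a => hu.mul (hcont a).aestronglyMeasurable
  have hF'm : AEStronglyMeasurable (fun x => star (u x) * (((inner ℝ ξ x : ℝ) - a * ‖ξ‖ ^ 2) *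
      Complex.exp (a * (inner ℝ ξ x : ℝ) - a ^ 2 * ‖ξ‖ ^ 2 / 2))) (gaussianMeasure d 1) :=
    hu.mul (Continuous.mul (by fun_prop) (hcont a)).aestronglyMeasurable
  have hbi : Integrable (fun x => ‖star (u x)‖ * (C * Real.exp ((R + 1) * |inner ℝ ξ x|)))
      (gaussianMeasure d 1) := hum.norm.integrable_mul hbm
  refine (hasDerivAt_integral_of_dominated_loc_of_deriv_le
    (F := fun (a : ℂ) x => star (u x) *
      Complex.exp (a * (inner ℝ ξ x : ℝ) - a ^ 2 * ‖ξ‖ ^ 2 / 2))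
    (F' := fun (a : ℂ) x => star (u x) * (((inner ℝ ξ x : ℝ) - a * ‖ξ‖ ^ 2) *
      Complex.exp (a * (inner ℝ ξ x : ℝ) - a ^ 2 * ‖ξ‖ ^ 2 / 2)))
    (bound := fun x => ‖star (u x)‖ * (C * Real.exp ((R + 1) * |inner ℝ ξ x|)))
    (Metric.ball_mem_nhds a one_pos) (Eventually.of_forall hFm) ?_ hF'm
    (Eventually.of_forall fun x a' ha' => ?_) hbi
    (Eventually.of_forall fun x a' _ => ?_)).2
  · exact hum.integrable_mul (memLp_exp_ridge a ξ)
  · have ha : ‖a'‖ ≤ R := by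
      have h2 : ‖a' - a‖ < 1 := by simpa [dist_eq_norm] using ha'
      have h3 := norm_add_le (a' - a) a
      rw [sub_add_cancel] at h3
      linarith
    rw [norm_mul, norm_mul]
    refine mul_le_mul_of_nonneg_left ?_ (norm_nonneg _)
    have h2 := norm_exp_profile_le_of_norm_le ha ‖ξ‖ (inner ℝ ξ x)
    have h3 : ‖((inner ℝ ξ x : ℝ) : ℂ) - a' * ‖ξ‖ ^ 2‖ ≤
        (1 + R * ‖ξ‖ ^ 2) * Real.exp |inner ℝ ξ x| := by
      refine (norm_sub_le _ _).trans ?_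
      rw [norm_mul, norm_pow, Complex.norm_real, Complex.norm_real, norm_norm, Real.norm_eq_abs]
      have h4 := Real.add_one_le_exp |inner ℝ ξ x|
      have h5 : ‖a'‖ * ‖ξ‖ ^ 2 ≤ R * ‖ξ‖ ^ 2 := by gcongr
      have h6 : R * ‖ξ‖ ^ 2 * 1 ≤ R * ‖ξ‖ ^ 2 * Real.exp |inner ℝ ξ x| := by
        gcongr
        exact Real.one_le_exp (abs_nonneg _)
      linarith
    calc _ ≤ ((1 + R * ‖ξ‖ ^ 2) * Real.exp |inner ℝ ξ x|) *
          (Real.exp (R ^ 2 * ‖ξ‖ ^ 2 / 2) * Real.exp (R * |inner ℝ ξ x|)) := by gcongr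
      _ = C * (Real.exp (R * |inner ℝ ξ x|) * Real.exp |inner ℝ ξ x|) := by rw [hC]; ring
      _ = _ := by rw [← Real.exp_add]; ring_nf
  · refine HasDerivAt.const_mul _ ?_
    have h2 : HasDerivAt (fun a : ℂ => a * (inner ℝ ξ x : ℝ) - a ^ 2 * ‖ξ‖ ^ 2 / 2)
        ((inner ℝ ξ x : ℝ) - a' * ‖ξ‖ ^ 2) a' := by
      have h3 := ((hasDerivAt_id a').mul_const ((inner ℝ ξ x : ℝ) : ℂ)).sub
        ((((hasDerivAt_id a').pow 2).mul_const ((‖ξ‖ : ℂ) ^ 2)).div_const 2)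
      refine h3.congr_deriv ?_
      simp
      ring
    rw [mul_comm]
    exact h2.cexp

/-- On normalised exponentials `L` coincides with `a d/da`. Symmetry moves `L` onto `u`, where it is
multiplication by `n`. -/
theorem mul_deriv_inner_expVec {n : ℕ} {u : GaussL2 d} (hu : u ∈ ouEigenspace d n) (a : ℂ)
    (ξ : EuclideanSpace ℝ (Fin d)) :
    a * (∫ x, star (u x) * (((inner ℝ ξ x : ℝ) - a * ‖ξ‖ ^ 2) *
      Complex.exp (a * (inner ℝ ξ x : ℝ) - a ^ 2 * ‖ξ‖ ^ 2 / 2)) ∂gaussianMeasure d 1) =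
      n * inner ℂ u (expVec a ξ) := by
  set c : ℂ := a ^ 2 * ‖ξ‖ ^ 2 / 2 with hc
  have hd : ∀ t : ℝ, HasDerivAt (fun t : ℝ => Complex.exp (a * t - c))
      (a * Complex.exp (a * t - c)) t := fun t => by
    have h1 : HasDerivAt (fun t : ℝ => a * (t : ℂ) - c) a t := by
      simpa using ((Complex.ofRealCLM.hasDerivAt (x := t)).const_mul a).sub_const c
    rw [mul_comm]
    exact h1.cexp
  set B := ‖Complex.exp (-c)‖ with hB
  have hE : ∀ t : ℝ, ‖Complex.exp (a * t - c)‖ ≤ B * Real.exp (‖a‖ * |t|) :=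
    norm_exp_profile_le a c
  have hm : MemLp (fun x =>
      ((inner ℝ ξ x : ℝ) : ℂ) * (a * Complex.exp (a * (inner ℝ ξ x : ℝ) - c)) -
      (‖ξ‖ : ℂ) ^ 2 * (a * (a * Complex.exp (a * (inner ℝ ξ x : ℝ) - c)))) 2
      (gaussianMeasure d 1) := by
    refine memLp_ridge (h := fun t : ℝ => (t : ℂ) * (a * Complex.exp (a * t - c)) -
      (‖ξ‖ : ℂ) ^ 2 * (a * (a * Complex.exp (a * t - c)))) (by fun_prop)
      (C := (‖a‖ + ‖ξ‖ ^ 2 * ‖a‖ ^ 2) * B) (c := ‖a‖ + 1) (by positivity) (fun t => ?_) ξ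
    have e1 : (t : ℂ) * (a * Complex.exp (a * t - c)) -
        (‖ξ‖ : ℂ) ^ 2 * (a * (a * Complex.exp (a * t - c))) =
        (t * a - (‖ξ‖ : ℂ) ^ 2 * a ^ 2) * Complex.exp (a * t - c) := by ring
    rw [e1, norm_mul]
    have e2 : ‖(t : ℂ) * a - (‖ξ‖ : ℂ) ^ 2 * a ^ 2‖ ≤
        (‖a‖ + ‖ξ‖ ^ 2 * ‖a‖ ^ 2) * Real.exp |t| := by
      refine (norm_sub_le _ _).trans ?_
      rw [norm_mul, norm_mul, norm_pow, norm_pow, Complex.norm_real, Complex.norm_real, norm_norm,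
        Real.norm_eq_abs, add_mul]
      have h1 := Real.add_one_le_exp |t|
      have h2 : 1 ≤ Real.exp |t| := Real.one_le_exp (abs_nonneg _)
      refine add_le_add ?_ (le_mul_of_one_le_right (by positivity) h2)
      rw [mul_comm]
      gcongr
      linarith
    calc _ ≤ ((‖a‖ + ‖ξ‖ ^ 2 * ‖a‖ ^ 2) * Real.exp |t|) * (B * Real.exp (‖a‖ * |t|)) := by
          gcongr
          exact hE t
      _ = (‖a‖ + ‖ξ‖ ^ 2 * ‖a‖ ^ 2) * B * (Real.exp (‖a‖ * |t|) * Real.exp |t|) := by ring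
      _ = _ := by rw [← Real.exp_add]; ring_nf
  have hB0 : 0 ≤ B := norm_nonneg _
  have hmem : (expVec a ξ, hm.toLp _) ∈ ouGraph d := by
    refine mem_ouGraph_ridge (h := fun t : ℝ => Complex.exp (a * t - c))
      (h' := fun t => a * Complex.exp (a * t - c))
      (h'' := fun t => a * (a * Complex.exp (a * t - c))) (C := (1 + ‖a‖ + ‖a‖ ^ 2) * B)
      (c := ‖a‖) ?_ hd (fun t => (hd t).const_mul a) (norm_nonneg a) (fun t => ?_) (fun t => ?_)
      (fun t => ?_) ξ (coeFn_expVec a ξ) hm.coeFn_toLp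
    · exact ((contDiff_const.mul Complex.ofRealCLM.contDiff).sub contDiff_const).cexp
    · refine (hE t).trans ?_
      gcongr
      nlinarith [norm_nonneg a]
    · rw [norm_mul]
      calc _ ≤ ‖a‖ * (B * Real.exp (‖a‖ * |t|)) := by gcongr; exact hE t
        _ = (‖a‖ * B) * Real.exp (‖a‖ * |t|) := by ring
        _ ≤ _ := by gcongr; nlinarith [norm_nonneg a]
    · rw [norm_mul, norm_mul]
      calc _ ≤ ‖a‖ * (‖a‖ * (B * Real.exp (‖a‖ * |t|))) := by gcongr; exact hE t
        _ = (‖a‖ ^ 2 * B) * Real.exp (‖a‖ * |t|) := by ring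
        _ ≤ _ := by gcongr; nlinarith [norm_nonneg a]
  have hsym := inner_ouGraph_comm (mem_ouEigenspace.1 hu) hmem
  simp only [inner_smul_left, map_natCast] at hsym
  rw [← hsym, L2.inner_def, ← integral_const_mul]
  refine integral_congr_ae ?_
  filter_upwards [hm.coeFn_toLp] with x hx
  rw [hx, RCLike.inner_apply]
  simp only [RCLike.star_def]
  ring

/-- The pairing `F` solves `a F' = n F`, so `F (exp (-t z) a) exp (t z n)` is constant in `t`;
compare `t = 1` and `t = 0`. Following this flow avoids dividing by `a`. -/
theorem inner_expVec_exp_mul {n : ℕ} {u : GaussL2 d} (hu : u ∈ ouEigenspace d n) (z a : ℂ)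
    (ξ : EuclideanSpace ℝ (Fin d)) :
    inner ℂ u (expVec (Complex.exp (-z) * a) ξ) =
      Complex.exp (-(z * n)) * inner ℂ u (expVec a ξ) := by
  set F : ℂ → ℂ := fun a => inner ℂ u (expVec a ξ) with hF
  have hFd : ∀ a, ∃ F', HasDerivAt F F' a ∧ a * F' = n * F a := fun a =>
    ⟨_, hasDerivAt_inner_expVec u a ξ, mul_deriv_inner_expVec hu a ξ⟩
  choose F' hF' hFe using hFd
  have hg : ∀ t : ℂ, HasDerivAt (fun t : ℂ => F (Complex.exp (t * -z) * a) *
      Complex.exp (t * (z * n))) 0 t := by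
    intro t
    have h1 : ∀ c : ℂ, HasDerivAt (fun t : ℂ => Complex.exp (t * c))
        (Complex.exp (t * c) * c) t := fun c => (hasDerivAt_mul_const c).cexp
    have h2 : HasDerivAt (fun t : ℂ => F (Complex.exp (t * -z) * a))
        (F' (Complex.exp (t * -z) * a) * (Complex.exp (t * -z) * -z * a)) t :=
      HasDerivAt.comp (h₂ := F) (h := fun t : ℂ => Complex.exp (t * -z) * a) t (hF' _)
        ((h1 (-z)).mul_const a)
    refine (h2.mul (h1 (z * n))).congr_deriv ?_
    have h3 := hFe (Complex.exp (t * -z) * a)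
    linear_combination (-z * Complex.exp (t * (z * n))) * h3
  have h := is_const_of_deriv_eq_zero (fun t => (hg t).differentiableAt) (fun t => (hg t).deriv) 1 0
  simp only [one_mul, zero_mul, Complex.exp_zero, mul_one] at h
  change F _ = _ * F a
  rw [← h, mul_comm (Complex.exp (-(z * n))), mul_assoc, ← Complex.exp_add,
    add_neg_cancel, Complex.exp_zero, mul_one]

theorem IsExpNegOU.apply_expVec {z : ℂ} {T : GaussL2 d →L[ℂ] GaussL2 d} (hT : IsExpNegOU d z T)
    (a : ℂ) (ξ : EuclideanSpace ℝ (Fin d)) :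
    T (expVec a ξ) = expVec (Complex.exp (-z) * a) ξ := by
  obtain ⟨ι, b, N, hb⟩ := exists_hilbertBasis_ou d
  refine b.ext_inner fun i => ?_
  rw [hT.inner_apply b hb, inner_expVec_exp_mul (hb i)]

end ExpNegOU

/-! ### Mehler's kernel represents the operator -/

section MehlerKernel

variable {d : ℕ}

theorem integral_cexp_neg_mul_norm_sq_add_sum {b : ℂ} (hb : 0 < b.re) (c : Fin d → ℂ) :
    ∫ y : EuclideanSpace ℝ (Fin d), Complex.exp (-b * ‖y‖ ^ 2 + ∑ i, c i * y i) =
      (Real.pi / b) ^ ((d : ℂ) / 2) * Complex.exp ((∑ i, c i ^ 2) / (4 * b)) := by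
  have h := GaussianFourier.integral_cexp_neg_mul_sum_add hb c
  rw [Fintype.card_fin] at h
  rw [← h, ← (PiLp.volume_preserving_toLp (Fin d)).integral_comp
    (MeasurableEquiv.toLp 2 _).measurableEmbedding]
  refine integral_congr_ae (Eventually.of_forall fun y => ?_)
  simp only [← Complex.ofReal_pow, EuclideanSpace.real_norm_sq_eq]
  push_cast
  rfl

/-- The coefficient `1 / (2 (1 - w²))` in the exponent of the Mehler kernel. -/
noncomputable def mehlerCoeff (w : ℂ) : ℂ := 1 / (2 * (1 - w ^ 2))

/-- The Mehler kernel with complex parameter `w`. -/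
noncomputable def mehlerKernel (w : ℂ) (x y : EuclideanSpace ℝ (Fin d)) : ℂ :=
  ((Real.pi / mehlerCoeff w) ^ ((d : ℂ) / 2))⁻¹ * Complex.exp (-mehlerCoeff w *
    (w ^ 2 * ‖x‖ ^ 2 - 2 * w * (inner ℝ x y : ℝ) + ‖y‖ ^ 2))

theorem one_sub_sq_ne_zero {w : ℂ} (hw : ‖w‖ < 1) : 1 - w ^ 2 ≠ 0 := by
  intro h
  have h1 : ‖w ^ 2‖ = 1 := by rw [← sub_eq_zero.1 h, norm_one]
  rw [norm_pow] at h1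
  nlinarith [norm_nonneg w]

/-- The coefficient is `1/4` plus a quarter of the Cayley transform of `w²`, which lies in the right
half-plane. The threshold `1/4` is what makes the kernel divided by the density square integrable
for `γ`. -/
theorem quarter_lt_re_mehlerCoeff {w : ℂ} (hw : ‖w‖ < 1) : 1 / 4 < (mehlerCoeff w).re := by
  have h0 := one_sub_sq_ne_zero hw
  have h1 : mehlerCoeff w = 1 / 4 + (1 + w ^ 2) / (1 - w ^ 2) / 4 := by
    rw [mehlerCoeff]
    field_simp
    ring
  have h2 : 0 < ((1 + w ^ 2) / (1 - w ^ 2)).re := by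
    have h3 : ‖w ^ 2‖ < 1 := by
      rw [norm_pow]
      exact pow_lt_one₀ (norm_nonneg _) hw two_ne_zero
    have h4 : Complex.normSq (w ^ 2) < 1 := by
      rw [Complex.normSq_eq_norm_sq]
      exact pow_lt_one₀ (norm_nonneg _) h3 two_ne_zero
    have h5 : 0 < Complex.normSq (1 - w ^ 2) := Complex.normSq_pos.2 h0
    rw [Complex.div_re, ← add_div]
    refine div_pos ?_ h5
    rw [Complex.normSq_apply] at h4
    simp only [Complex.add_re, Complex.sub_re, Complex.one_re, Complex.add_im, Complex.sub_im,
      Complex.one_im]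
    nlinarith
  rw [h1, Complex.add_re, Complex.div_ofNat_re, Complex.div_ofNat_re, Complex.one_re]
  linarith

theorem continuous_mehlerKernel (w : ℂ) : Continuous fun z : EuclideanSpace ℝ (Fin d) ×
    EuclideanSpace ℝ (Fin d) => mehlerKernel w z.1 z.2 := by
  unfold mehlerKernel
  fun_prop

theorem pi_div_mehlerCoeff_ne_zero {w : ℂ} (hw : ‖w‖ < 1) : (Real.pi : ℂ) / mehlerCoeff w ≠ 0 := by
  refine div_ne_zero (by exact_mod_cast Real.pi_ne_zero) fun h => ?_
  have h1 := quarter_lt_re_mehlerCoeff hw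
  rw [h, Complex.zero_re] at h1
  linarith

theorem integral_mehlerKernel_mul_exp {w : ℂ} (hw : ‖w‖ < 1) (x ξ : EuclideanSpace ℝ (Fin d)) :
    ∫ y, mehlerKernel w x y *
      Complex.exp (Complex.I * (inner ℝ ξ y : ℝ) - Complex.I ^ 2 * ‖ξ‖ ^ 2 / 2) =
      Complex.exp (w * Complex.I * (inner ℝ ξ x : ℝ) - (w * Complex.I) ^ 2 * ‖ξ‖ ^ 2 / 2) := by
  set b := mehlerCoeff w with hb
  have hbre : 0 < b.re := by linarith [quarter_lt_re_mehlerCoeff hw]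
  have hb0 : b ≠ 0 := fun h => by rw [h, Complex.zero_re] at hbre; exact lt_irrefl _ hbre
  have hin : ∀ u v : EuclideanSpace ℝ (Fin d), ((inner ℝ u v : ℝ) : ℂ) = ∑ i, (u i : ℂ) * v i := by
    intro u v
    rw [PiLp.inner_apply]
    push_cast
    exact Finset.sum_congr rfl fun i _ => by simp [mul_comm]
  have hns : ∀ u : EuclideanSpace ℝ (Fin d), (‖u‖ : ℂ) ^ 2 = ∑ i, (u i : ℂ) ^ 2 := by
    intro u
    rw [← Complex.ofReal_pow, EuclideanSpace.real_norm_sq_eq]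
    push_cast
    rfl
  -- These are the complex coefficients of the linear form in `y`, from the kernel and the
  -- exponential together.
  set c : Fin d → ℂ := fun i => 2 * b * w * x i + Complex.I * ξ i with hc
  have h1 : ∀ y : EuclideanSpace ℝ (Fin d), mehlerKernel w x y *
      Complex.exp (Complex.I * (inner ℝ ξ y : ℝ) - Complex.I ^ 2 * ‖ξ‖ ^ 2 / 2) =
      (((Real.pi / b) ^ ((d : ℂ) / 2))⁻¹ *
        Complex.exp (-b * w ^ 2 * ‖x‖ ^ 2 - Complex.I ^ 2 * ‖ξ‖ ^ 2 / 2)) *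
      Complex.exp (-b * ‖y‖ ^ 2 + ∑ i, c i * y i) := by
    intro y
    have e : ∑ i, c i * (y i : ℂ) = 2 * b * w * (inner ℝ x y : ℝ) +
        Complex.I * (inner ℝ ξ y : ℝ) := by
      rw [hin, hin, Finset.mul_sum, Finset.mul_sum, ← Finset.sum_add_distrib]
      exact Finset.sum_congr rfl fun i _ => by rw [hc]; ring
    rw [mehlerKernel, ← hb, mul_assoc _ (Complex.exp _) (Complex.exp _), ← Complex.exp_add,
      mul_assoc _ (Complex.exp _) (Complex.exp _), ← Complex.exp_add, e]
    ring_nf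
  simp_rw [h1]
  rw [integral_const_mul, integral_cexp_neg_mul_norm_sq_add_sum hbre]
  have hne : ((Real.pi : ℂ) / b) ^ ((d : ℂ) / 2) ≠ 0 := by
    rw [Complex.cpow_def_of_ne_zero (pi_div_mehlerCoeff_ne_zero hw)]
    exact Complex.exp_ne_zero _
  rw [mul_mul_mul_comm, inv_mul_cancel₀ hne, one_mul, ← Complex.exp_add]
  congr 1
  have e : ∑ i, c i ^ 2 = 4 * b ^ 2 * w ^ 2 * ‖x‖ ^ 2 +
      4 * b * w * Complex.I * (inner ℝ ξ x : ℝ) + Complex.I ^ 2 * ‖ξ‖ ^ 2 := by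
    rw [hin, hns, hns, Finset.mul_sum, Finset.mul_sum, Finset.mul_sum, ← Finset.sum_add_distrib,
      ← Finset.sum_add_distrib]
    exact Finset.sum_congr rfl fun i _ => by rw [hc]; ring
  have hw0 := one_sub_sq_ne_zero hw
  have hbw : b * (2 * (1 - w ^ 2)) = 1 := by
    rw [hb, mehlerCoeff, one_div_mul_cancel]
    exact mul_ne_zero two_ne_zero hw0
  have e2 : (∑ i, c i ^ 2) / (4 * b) = b * w ^ 2 * ‖x‖ ^ 2 + w * Complex.I * (inner ℝ ξ x : ℝ) +
      Complex.I ^ 2 * ‖ξ‖ ^ 2 * ((1 - w ^ 2) / 2) := by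
    rw [e, div_eq_iff (mul_ne_zero (by norm_num) hb0)]
    linear_combination (-Complex.I ^ 2 * ‖ξ‖ ^ 2) * hbw
  rw [e2]
  ring

theorem norm_mehlerKernel (w : ℂ) (x y : EuclideanSpace ℝ (Fin d)) :
    ‖mehlerKernel w x y‖ = ‖((Real.pi : ℂ) / mehlerCoeff w) ^ ((d : ℂ) / 2)‖⁻¹ *
      Real.exp (-((mehlerCoeff w * w ^ 2).re * ‖x‖ ^ 2) +
        2 * (mehlerCoeff w * w).re * inner ℝ x y - (mehlerCoeff w).re * ‖y‖ ^ 2) := by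
  rw [mehlerKernel, norm_mul, norm_inv, Complex.norm_exp]
  congr 2
  have e : -mehlerCoeff w * (w ^ 2 * ‖x‖ ^ 2 - 2 * w * (inner ℝ x y : ℝ) + ‖y‖ ^ 2) =
      -(((‖x‖ ^ 2 : ℝ) : ℂ) * (mehlerCoeff w * w ^ 2)) +
        ((2 * inner ℝ x y : ℝ) : ℂ) * (mehlerCoeff w * w) -
        ((‖y‖ ^ 2 : ℝ) : ℂ) * mehlerCoeff w := by
    push_cast
    ring
  rw [e, Complex.sub_re, Complex.add_re, Complex.neg_re, Complex.re_ofReal_mul,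
    Complex.re_ofReal_mul, Complex.re_ofReal_mul]
  ring

theorem memLp_mehlerKernel_div {w : ℂ} (hw : ‖w‖ < 1) (x : EuclideanSpace ℝ (Fin d)) :
    MemLp (fun y => star (mehlerKernel w x y) / (gaussianDensity d 1 y : ℂ)) 2
      (gaussianMeasure d 1) := by
  have hpos := gaussianDensity_pos d one_pos
  have hcont : Continuous fun y => star (mehlerKernel w x y) / (gaussianDensity d 1 y : ℂ) := by
    refine Continuous.div ?_ ?_ fun y => by exact_mod_cast (hpos y).ne'
    · exact ((continuous_mehlerKernel w).comp (by fun_prop : Continuous fun y => (x, y))).star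
    · exact Complex.continuous_ofReal.comp (continuous_gaussianDensity d 1)
  rw [memLp_two_iff_integrable_sq_norm hcont.aestronglyMeasurable,
    integrable_gaussianMeasure_iff one_pos]
  set b := mehlerCoeff w with hb
  have hb4 := quarter_lt_re_mehlerCoeff hw
  set A := ‖((Real.pi : ℂ) / b) ^ ((d : ℂ) / 2)‖⁻¹ with hA
  set D := (2 * Real.pi * 1) ^ (-(d : ℝ) / 2) with hD
  have hD0 : 0 < D := by
    have := Real.pi_pos
    positivity
  -- The squared kernel decays like `exp (-2 b.re |y|²)`; one remaining factor `1 / density` grows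
  -- like `exp (|y|² / 2)`.
  have hdom := (integrable_exp_mul_norm_sub d (a := 2 * b.re - 1 / 2) (by linarith)
    (2 * |2 * (b * w).re| * ‖x‖)).const_mul
    (A ^ 2 * D⁻¹ * Real.exp (-2 * ((b * w ^ 2).re * ‖x‖ ^ 2)))
  refine hdom.mono' ?_ (Eventually.of_forall fun y => ?_)
  · exact ((continuous_gaussianDensity d 1).smul (hcont.norm.pow 2)).aestronglyMeasurable
  · rw [norm_smul, Real.norm_of_nonneg (hpos y).le, norm_pow, norm_norm, norm_div, norm_star,
      Complex.norm_real, Real.norm_of_nonneg (hpos y).le, norm_mehlerKernel, ← hb, ← hA]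
    have e1 : ∀ m g : ℝ, 0 < g → g * (m / g) ^ 2 = m ^ 2 * g⁻¹ := fun m g hg => by
      field_simp
    rw [e1 _ _ (hpos y), gaussianDensity, ← hD, mul_inv, ← Real.exp_neg, mul_pow, ← Real.exp_nat_mul]
    have e2 : ∀ a b c e : ℝ, a * b * (c * e) = a * c * (b * e) := fun a b c e => by ring
    rw [e2, ← Real.exp_add, mul_assoc (A ^ 2 * D⁻¹), ← Real.exp_add]
    have hA0 : 0 ≤ A := by rw [hA]; positivity
    refine mul_le_mul_of_nonneg_left (Real.exp_le_exp.2 ?_) (by positivity)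
    have h1 := abs_real_inner_le_norm x y
    have h2 : 2 * (b * w).re * inner ℝ x y ≤ |2 * (b * w).re| * (‖x‖ * ‖y‖) := by
      refine (le_abs_self _).trans ?_
      rw [abs_mul]
      gcongr
    push_cast
    linarith

/-- The vector representing `u ↦ ∫ mehlerKernel w x y * u y dy` on `L²(γ)`. -/
noncomputable def mehlerVec {w : ℂ} (hw : ‖w‖ < 1) (x : EuclideanSpace ℝ (Fin d)) : GaussL2 d :=
  (memLp_mehlerKernel_div hw x).toLp _

theorem inner_mehlerVec {w : ℂ} (hw : ‖w‖ < 1) (x : EuclideanSpace ℝ (Fin d)) {u : GaussL2 d}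
    {f : EuclideanSpace ℝ (Fin d) → ℂ} (hf : u =ᵐ[gaussianMeasure d 1] f) :
    inner ℂ (mehlerVec hw x) u = ∫ y, mehlerKernel w x y * f y := by
  rw [L2.inner_def]
  have h : ∫ y, inner ℂ (mehlerVec hw x y) (u y) ∂gaussianMeasure d 1 =
      ∫ y, mehlerKernel w x y / (gaussianDensity d 1 y : ℂ) * f y ∂gaussianMeasure d 1 := by
    refine integral_congr_ae ?_
    filter_upwards [hf, (memLp_mehlerKernel_div hw x).coeFn_toLp] with y h1 h2
    rw [mehlerVec, h2, h1, RCLike.inner_apply]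
    simp [mul_comm]
  rw [h, integral_gaussianMeasure one_pos]
  refine integral_congr_ae (Eventually.of_forall fun y => ?_)
  have h0 : (gaussianDensity d 1 y : ℂ) ≠ 0 := by
    exact_mod_cast (gaussianDensity_pos d one_pos y).ne'
  simp only [Complex.real_smul]
  field_simp

/-- The vectors satisfying the identity form a closed subspace containing a total set. For
closedness, `T (v n)` converges almost everywhere along a subsequence, while the pairings with `k x`
converge for every `x`. -/
theorem ae_eq_inner_of_expVec {T : GaussL2 d →L[ℂ] GaussL2 d}
    (k : EuclideanSpace ℝ (Fin d) → GaussL2 d)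
    (h : ∀ ξ, T (expVec Complex.I ξ) =ᵐ[gaussianMeasure d 1]
      fun x => inner ℂ (k x) (expVec Complex.I ξ)) (u : GaussL2 d) :
    T u =ᵐ[gaussianMeasure d 1] fun x => inner ℂ (k x) u := by
  let K : Submodule ℂ (GaussL2 d) :=
    { carrier := {u | T u =ᵐ[gaussianMeasure d 1] fun x => inner ℂ (k x) u}
      add_mem' := fun {u v} hu hv => by
        simp only [Set.mem_ofPred_eq] at *
        rw [map_add]
        filter_upwards [Lp.coeFn_add (T u) (T v), hu, hv] with x h1 h2 h3
        rw [h1, Pi.add_apply, h2, h3, inner_add_right]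
      zero_mem' := by
        simp only [Set.mem_ofPred_eq, map_zero, inner_zero_right]
        exact Lp.coeFn_zero _ _ _
      smul_mem' := fun c u hu => by
        simp only [Set.mem_ofPred_eq] at *
        rw [map_smul]
        filter_upwards [Lp.coeFn_smul c (T u), hu] with x h1 h2
        rw [h1, Pi.smul_apply, h2, inner_smul_right, smul_eq_mul] }
  have hclosed : IsClosed (K : Set (GaussL2 d)) := by
    refine IsSeqClosed.isClosed fun v u hv hvu => ?_
    have h1 : Tendsto (fun n => T (v n)) atTop (𝓝 (T u)) := (T.continuous.tendsto u).comp hvu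
    obtain ⟨ns, hns, hae⟩ := (tendstoInMeasure_of_tendsto_Lp h1).exists_seq_tendsto_ae
    have h2 : ∀ᵐ x ∂gaussianMeasure d 1, ∀ n, T (v n) x = inner ℂ (k x) (v n) :=
      ae_all_iff.2 hv
    change T u =ᵐ[gaussianMeasure d 1] fun x => inner ℂ (k x) u
    filter_upwards [hae, h2] with x hx hx2
    simp only [hx2] at hx
    refine tendsto_nhds_unique hx ?_
    exact (Continuous.tendsto (f := fun v : GaussL2 d => inner ℂ (k x) v) (by fun_prop) u).comp
      (hvu.comp hns.tendsto_atTop)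
  have htop : K = ⊤ := by
    rw [← hclosed.submodule_topologicalClosure_eq, Submodule.topologicalClosure_eq_top_iff,
      Submodule.eq_bot_iff]
    intro v hv
    exact eq_zero_of_inner_expVec_eq_zero fun ξ => (Submodule.mem_orthogonal' _ v).1 hv _ (h ξ)
  have hu : u ∈ K := by rw [htop]; exact Submodule.mem_top
  exact hu

/-- The operator `exp (-zL)` is the integral operator with Mehler's kernel. -/
theorem IsExpNegOU.ae_eq_integral {z : ℂ} (hz : 0 < z.re) {T : GaussL2 d →L[ℂ] GaussL2 d}
    (hT : IsExpNegOU d z T) (u : GaussL2 d) :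
    T u =ᵐ[gaussianMeasure d 1] fun x => ∫ y, mehlerKernel (Complex.exp (-z)) x y * u y := by
  have hw : ‖Complex.exp (-z)‖ < 1 := by
    rw [Complex.norm_exp, Complex.neg_re, Real.exp_lt_one_iff]
    linarith
  refine (ae_eq_inner_of_expVec (mehlerVec hw) (fun ξ => ?_) u).trans
    (Eventually.of_forall fun x => inner_mehlerVec hw x EventuallyEq.rfl)
  rw [hT.apply_expVec]
  refine (coeFn_expVec _ ξ).trans (Eventually.of_forall fun x => ?_)
  simp only
  rw [inner_mehlerVec hw x (coeFn_expVec Complex.I ξ), integral_mehlerKernel_mul_exp hw]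

end MehlerKernel

/-! ### The weighted kernel bound -/

section MehlerBound

variable {d : ℕ}

/-- Completing the square in `y` leaves `(Q - R² / P) |x|²`, which is nonnegative by `h`. -/
theorem mul_norm_sub_sq_le {P Q R : ℝ} (hP : 0 < P) (h : R ^ 2 ≤ P * Q)
    (x y : EuclideanSpace ℝ (Fin d)) :
    P * ‖y - (R / P) • x‖ ^ 2 ≤ Q * ‖x‖ ^ 2 - 2 * R * inner ℝ x y + P * ‖y‖ ^ 2 := by
  rw [norm_sub_sq_real, inner_smul_right, norm_smul, mul_pow, Real.norm_eq_abs, sq_abs,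
    real_inner_comm]
  have h1 : R ^ 2 / P ≤ Q := by
    rw [div_le_iff₀ hP]
    linarith
  have h2 : P * (‖y‖ ^ 2 - 2 * (R / P * inner ℝ x y) + (R / P) ^ 2 * ‖x‖ ^ 2) =
      P * ‖y‖ ^ 2 - 2 * R * inner ℝ x y + R ^ 2 / P * ‖x‖ ^ 2 := by
    field_simp
  rw [h2]
  nlinarith [mul_le_mul_of_nonneg_right h1 (sq_nonneg ‖x‖)]

/-- After completing the square, translation invariance removes the centre `(R / P) • x`, so the
bound does not depend on `x`. -/
theorem lintegral_exp_quadratic_rpow_le {P Q R r c : ℝ} (hP : 0 < P) (h : R ^ 2 ≤ P * Q)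
    (hr : 0 < r) (hc : 0 ≤ c) (x : EuclideanSpace ℝ (Fin d)) :
    ∫⁻ y, ENNReal.ofReal (c * Real.exp (-(1 / 4) *
      (Q * ‖x‖ ^ 2 - 2 * R * inner ℝ x y + P * ‖y‖ ^ 2))) ^ r ≤
      ENNReal.ofReal (c ^ r * (4 * Real.pi / (r * P)) ^ ((d : ℝ) / 2)) := by
  have hb : 0 < r * P / 4 := by positivity
  have hint : Integrable fun y : EuclideanSpace ℝ (Fin d) =>
      Real.exp (-(r * P / 4) * ‖y‖ ^ 2) := by
    have h1 := integrable_exp_mul_norm_sub d hb 0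
    simpa using h1
  calc _ ≤ ∫⁻ y, ENNReal.ofReal (c ^ r) *
        ENNReal.ofReal (Real.exp (-(r * P / 4) * ‖y - (R / P) • x‖ ^ 2)) := by
        refine lintegral_mono fun y => ?_
        rw [ENNReal.ofReal_rpow_of_nonneg (by positivity) hr.le,
          ← ENNReal.ofReal_mul (by positivity), Real.mul_rpow hc (Real.exp_pos _).le,
          ← Real.exp_mul]
        refine ENNReal.ofReal_le_ofReal
          (mul_le_mul_of_nonneg_left (Real.exp_le_exp.2 ?_) (by positivity))
        nlinarith [mul_norm_sub_sq_le hP h x y]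
    _ = ENNReal.ofReal (c ^ r) * ∫⁻ y : EuclideanSpace ℝ (Fin d),
        ENNReal.ofReal (Real.exp (-(r * P / 4) * ‖y‖ ^ 2)) := by
        rw [lintegral_const_mul _ (by fun_prop), lintegral_sub_right_eq_self
          (fun y : EuclideanSpace ℝ (Fin d) =>
            ENNReal.ofReal (Real.exp (-(r * P / 4) * ‖y‖ ^ 2)))]
    _ = _ := by
        rw [← ofReal_integral_eq_lintegral_ofReal hint (Eventually.of_forall fun y =>
          (Real.exp_pos _).le), GaussianFourier.integral_rexp_neg_mul_sq_norm hb,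
          finrank_euclideanSpace_fin, ← ENNReal.ofReal_mul (by positivity)]
        congr 3
        field_simp

theorem gaussianDensity_rpow {τ : ℝ} (hτ : 0 < τ) (x : EuclideanSpace ℝ (Fin d)) (e : ℝ) :
    gaussianDensity d τ x ^ e =
      ((2 * Real.pi * τ) ^ (-(d : ℝ) / 2)) ^ e * Real.exp (-(e / (2 * τ)) * ‖x‖ ^ 2) := by
  have := Real.pi_pos
  rw [gaussianDensity, Real.mul_rpow (by positivity) (Real.exp_pos _).le, ← Real.exp_mul]
  congr 2
  ring

/-- The constant in front of the exponential after moving Gaussian weights into the kernel. -/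
noncomputable def weightedMehlerConst (d : ℕ) (p q α β : ℝ) (w : ℂ) : ℝ :=
  ((2 * Real.pi * ‖1 - w ^ 2‖) ^ ((d : ℝ) / 2))⁻¹ *
    ((2 * Real.pi * β) ^ (-(d : ℝ) / 2)) ^ (1 / q) *
    (((2 * Real.pi * α) ^ (-(d : ℝ) / 2)) ^ (1 / p))⁻¹

theorem norm_mehlerKernel_mul_rpow {p q α β : ℝ} (hα : 0 < α) (hβ : 0 < β)
    {w : ℂ} (hw : ‖w‖ < 1) (x y : EuclideanSpace ℝ (Fin d)) :
    gaussianDensity d β x ^ (1 / q) * ‖mehlerKernel w x y‖ =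
      weightedMehlerConst d p q α β w * Real.exp (-(1 / 4) *
        ((2 / (β * q) - 1 + ((1 + w ^ 2) / (1 - w ^ 2)).re) * ‖x‖ ^ 2 -
          2 * (2 * w / (1 - w ^ 2)).re * inner ℝ x y +
          (1 - 2 / (α * p) + ((1 + w ^ 2) / (1 - w ^ 2)).re) * ‖y‖ ^ 2)) *
        gaussianDensity d α y ^ (1 / p) := by
  have hπ := Real.pi_pos
  have hw0 := one_sub_sq_ne_zero hw
  set ρ := ((1 + w ^ 2) / (1 - w ^ 2)).re with hρ
  have e1 : (mehlerCoeff w).re = (1 + ρ) / 4 := by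
    have h : mehlerCoeff w = (1 + (1 + w ^ 2) / (1 - w ^ 2)) / 4 := by
      rw [mehlerCoeff]; field_simp; ring
    rw [h, Complex.div_ofNat_re, Complex.add_re, Complex.one_re]
  have e2 : (mehlerCoeff w * w ^ 2).re = (ρ - 1) / 4 := by
    have h : mehlerCoeff w * w ^ 2 = ((1 + w ^ 2) / (1 - w ^ 2) - 1) / 4 := by
      rw [mehlerCoeff]; field_simp; ring
    rw [h, Complex.div_ofNat_re, Complex.sub_re, Complex.one_re]
  have e3 : (mehlerCoeff w * w).re = (2 * w / (1 - w ^ 2)).re / 4 := by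
    have h : mehlerCoeff w * w = 2 * w / (1 - w ^ 2) / 4 := by
      rw [mehlerCoeff]; field_simp; ring
    rw [h, Complex.div_ofNat_re]
  have e4 : ‖((Real.pi : ℂ) / mehlerCoeff w) ^ ((d : ℂ) / 2)‖ =
      (2 * Real.pi * ‖1 - w ^ 2‖) ^ ((d : ℝ) / 2) := by
    have h : ((d : ℂ) / 2) = (((d : ℝ) / 2 : ℝ) : ℂ) := by push_cast; rfl
    have h2 : (Real.pi : ℂ) / mehlerCoeff w = 2 * Real.pi * (1 - w ^ 2) := by
      rw [mehlerCoeff]; field_simp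
    rw [h, Complex.norm_cpow_real, h2, norm_mul, norm_mul, Complex.norm_two, Complex.norm_real,
      Real.norm_of_nonneg hπ.le]
  rw [norm_mehlerKernel, e1, e2, e3, e4, gaussianDensity_rpow hβ, gaussianDensity_rpow hα,
    weightedMehlerConst]
  have hA : (((2 * Real.pi * α) ^ (-(d : ℝ) / 2)) ^ (1 / p)) ≠ 0 := by positivity
  set A := (((2 * Real.pi * α) ^ (-(d : ℝ) / 2)) ^ (1 / p)) with hA'
  set B := (((2 * Real.pi * β) ^ (-(d : ℝ) / 2)) ^ (1 / q)) with hB'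
  set M := ((2 * Real.pi * ‖1 - w ^ 2‖) ^ ((d : ℝ) / 2))⁻¹ with hM'
  have h1 : ∀ E1 E2 E3 E4 : ℝ, E1 + E2 = E3 + E4 →
      B * Real.exp E1 * (M * Real.exp E2) = M * B * A⁻¹ * Real.exp E3 * (A * Real.exp E4) := by
    intro E1 E2 E3 E4 hE
    calc _ = M * B * (Real.exp E1 * Real.exp E2) := by ring
      _ = M * B * (A⁻¹ * A) * (Real.exp E3 * Real.exp E4) := by
        rw [← Real.exp_add, ← Real.exp_add, hE, inv_mul_cancel₀ hA, mul_one]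
      _ = _ := by ring
  apply h1
  have i1 : 1 / q / (2 * β) = 2 / (β * q) / 4 := by ring
  have i2 : 1 / p / (2 * α) = 2 / (α * p) / 4 := by ring
  rw [i1, i2]
  ring

theorem weightedMehlerConst_eq {p q r α β P Q : ℝ} (hp : 1 ≤ p) (hq : 1 ≤ q) (hr1 : 1 ≤ r)
    (hr : 1 / r = 1 - (1 / p - 1 / q)) (hα : 0 < α) (hβ : 0 < β) (hP : 0 < P) (hQ : 0 < Q)
    {w : ℂ} (hw : ‖w‖ < 1) :
    (weightedMehlerConst d p q α β w ^ r * (4 * Real.pi / (r * P)) ^ ((d : ℝ) / 2)) ^ (1 - 1 / p) *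
      (weightedMehlerConst d p q α β w ^ r * (4 * Real.pi / (r * Q)) ^ ((d : ℝ) / 2)) ^ (1 / q) =
    2 ^ d * schurConst d p q r α β / ‖1 - w ^ 2‖ ^ ((d : ℝ) / 2) *
      (1 / (P ^ ((d : ℝ) / 2 * (1 - 1 / p)) * Q ^ ((d : ℝ) / 2 * (1 / q)))) := by
  have hπ := Real.pi_pos
  have hp0 : 0 < p := by linarith
  have hq0 : 0 < q := by linarith
  have hr0 : 0 < r := by linarith
  have hm : 0 < ‖1 - w ^ 2‖ := norm_pos_iff.2 (one_sub_sq_ne_zero hw)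
  set m := ‖1 - w ^ 2‖ with hm'
  have hc : 0 < weightedMehlerConst d p q α β w := by
    rw [weightedMehlerConst]
    positivity
  have hlc : Real.log (weightedMehlerConst d p q α β w) =
      -((d : ℝ) / 2 * (Real.log 2 + Real.log Real.pi + Real.log m)) +
      1 / q * (-(d : ℝ) / 2 * (Real.log 2 + Real.log Real.pi + Real.log β)) -
      1 / p * (-(d : ℝ) / 2 * (Real.log 2 + Real.log Real.pi + Real.log α)) := by
    rw [weightedMehlerConst, ← hm', Real.log_mul (by positivity) (by positivity),
      Real.log_mul (by positivity) (by positivity), Real.log_inv, Real.log_inv,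
      Real.log_rpow (by positivity), Real.log_rpow (by positivity), Real.log_rpow (by positivity),
      Real.log_rpow (by positivity), Real.log_rpow (by positivity),
      Real.log_mul (by positivity) hm.ne', Real.log_mul (by positivity) hβ.ne',
      Real.log_mul (by positivity) hα.ne', Real.log_mul (by positivity) hπ.ne']
    ring
  set c := weightedMehlerConst d p q α β w with hc'
  have hl4 : Real.log 4 = 2 * Real.log 2 := by
    rw [show (4 : ℝ) = 2 ^ (2 : ℕ) by norm_num, Real.log_pow]
    norm_num
  have hS : 0 < schurConst d p q r α β := by
    rw [schurConst]
    positivity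
  have hlS : Real.log (schurConst d p q r α β) =
      (d : ℝ) / 2 * -(Real.log 2 + Real.log r) +
      (d : ℝ) / (2 * p) * (Real.log α + Real.log r - Real.log 2) -
      (d : ℝ) / (2 * q) * (Real.log β + Real.log r - Real.log 2) := by
    rw [schurConst, Real.log_mul (by positivity) (by positivity),
      Real.log_mul (by positivity) (by positivity), Real.log_rpow (by positivity),
      Real.log_rpow (by positivity), Real.log_rpow (by positivity), one_div, Real.log_inv,
      Real.log_mul two_ne_zero hr0.ne', Real.log_div (by positivity) two_ne_zero,
      Real.log_div (by positivity) two_ne_zero, Real.log_mul hα.ne' hr0.ne',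
      Real.log_mul hβ.ne' hr0.ne']
    ring
  -- Both sides are products of positive powers. After taking logarithms, the only relation needed
  -- among the exponents is `r (1 - 1/p + 1/q) = 1`.
  refine Real.log_injOn_pos (Set.mem_Ioi.2 (by positivity)) (Set.mem_Ioi.2 (by positivity)) ?_
  have hl : ∀ T : ℝ, 0 < T → Real.log (c ^ r * (4 * Real.pi / (r * T)) ^ ((d : ℝ) / 2)) =
      r * Real.log c + (d : ℝ) / 2 *
        (2 * Real.log 2 + Real.log Real.pi - (Real.log r + Real.log T)) := by
    intro T hT
    rw [Real.log_mul (by positivity) (by positivity), Real.log_rpow hc,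
      Real.log_rpow (by positivity), Real.log_div (by positivity) (by positivity),
      Real.log_mul (by norm_num) hπ.ne', Real.log_mul hr0.ne' hT.ne', hl4]
  rw [Real.log_mul (by positivity) (by positivity), Real.log_rpow (by positivity),
    Real.log_rpow (by positivity), hl P hP, hl Q hQ, Real.log_mul (by positivity) (by positivity),
    Real.log_div (by positivity) (by positivity), Real.log_mul (by positivity) hS.ne',
    Real.log_pow, Real.log_rpow hm, one_div (_ * _), Real.log_inv,
    Real.log_mul (by positivity) (by positivity), Real.log_rpow hP, Real.log_rpow hQ, hlS]
  have hrq : r * (1 - 1 / p + 1 / q) = 1 := by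
    have : 1 - 1 / p + 1 / q = 1 / r := by linarith
    rw [this]
    field_simp
  have e1 : (d : ℝ) / (2 * p) = (d : ℝ) / 2 * (1 / p) := by field_simp
  have e2 : (d : ℝ) / (2 * q) = (d : ℝ) / 2 * (1 / q) := by field_simp
  rw [e1, e2]
  generalize 1 / p = p' at *
  generalize 1 / q = q' at *
  have e3 : r * Real.log c * (1 - p' + q') = Real.log c := by
    linear_combination Real.log c * hrq
  rw [hlc] at e3 ⊢
  linear_combination e3

theorem lintegral_mehlerKernel_le {p q r α β : ℝ} (hp : 1 ≤ p) (hq : 1 ≤ q) (hr1 : 1 ≤ r)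
    (hr : 1 / r = 1 - (1 / p - 1 / q)) (hα : 0 < α) (hβ : 0 < β) {w : ℂ} (hw : ‖w‖ < 1)
    (hP : 0 < 1 - 2 / (α * p) + ((1 + w ^ 2) / (1 - w ^ 2)).re)
    (hQ : 0 < 2 / (β * q) - 1 + ((1 + w ^ 2) / (1 - w ^ 2)).re)
    (hR : (2 * w / (1 - w ^ 2)).re ^ 2 ≤ (1 - 2 / (α * p) + ((1 + w ^ 2) / (1 - w ^ 2)).re) *
      (2 / (β * q) - 1 + ((1 + w ^ 2) / (1 - w ^ 2)).re))
    {f : EuclideanSpace ℝ (Fin d) → ℂ} (hf : AEStronglyMeasurable f) :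
    (∫⁻ x, (∫⁻ y, ‖mehlerKernel w x y * f y‖ₑ) ^ q ∂gaussianMeasure d β) ^ (1 / q) ≤
      ENNReal.ofReal (2 ^ d * schurConst d p q r α β / ‖1 - w ^ 2‖ ^ ((d : ℝ) / 2) *
        (1 / ((1 - 2 / (α * p) + ((1 + w ^ 2) / (1 - w ^ 2)).re) ^ ((d : ℝ) / 2 * (1 - 1 / p)) *
          (2 / (β * q) - 1 + ((1 + w ^ 2) / (1 - w ^ 2)).re) ^ ((d : ℝ) / 2 * (1 / q))))) *
      (∫⁻ y, ‖f y‖ₑ ^ p ∂gaussianMeasure d α) ^ (1 / p) := by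
  have hπ := Real.pi_pos
  have hp0 : 0 < p := by linarith
  have hq0 : 0 < q := by linarith
  have hr0 : 0 < r := by linarith
  rw [← weightedMehlerConst_eq hp hq hr1 hr hα hβ hP hQ hw]
  have hid := fun x y => norm_mehlerKernel_mul_rpow (d := d) (p := p) (q := q) hα hβ hw x y
  set P := 1 - 2 / (α * p) + ((1 + w ^ 2) / (1 - w ^ 2)).re with hP'
  set Q := 2 / (β * q) - 1 + ((1 + w ^ 2) / (1 - w ^ 2)).re with hQ'
  set R := (2 * w / (1 - w ^ 2)).re with hR'
  have hc : 0 ≤ weightedMehlerConst d p q α β w := by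
    rw [weightedMehlerConst]
    positivity
  set c := weightedMehlerConst d p q α β w with hc'
  let k : EuclideanSpace ℝ (Fin d) → EuclideanSpace ℝ (Fin d) → ℝ≥0∞ := fun x y =>
    ENNReal.ofReal (c * Real.exp (-(1 / 4) * (Q * ‖x‖ ^ 2 - 2 * R * inner ℝ x y + P * ‖y‖ ^ 2)))
  -- The weight of `γ_α` goes into `g` and is compensated in `k`; that of `γ_β` goes into `k`. The
  -- Schur test then runs on Lebesgue measure on both sides.
  let g : EuclideanSpace ℝ (Fin d) → ℝ≥0∞ := fun y =>
    ENNReal.ofReal (gaussianDensity d α y ^ (1 / p)) * ‖f y‖ₑ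
  have hk : Measurable (Function.uncurry k) := by
    refine Continuous.measurable (ENNReal.continuous_ofReal.comp ?_)
    fun_prop
  have hdm : Measurable fun y : EuclideanSpace ℝ (Fin d) =>
      ENNReal.ofReal (gaussianDensity d α y ^ (1 / p)) :=
    ((continuous_gaussianDensity d α).measurable.pow_const _).ennreal_ofReal
  have hg : AEMeasurable g := hdm.aemeasurable.mul hf.enorm
  have hrpow : ∀ {τ e : ℝ}, 0 < τ → 0 < e → ∀ x : EuclideanSpace ℝ (Fin d),
      ENNReal.ofReal (gaussianDensity d τ x ^ (1 / e)) ^ e =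
        ENNReal.ofReal (gaussianDensity d τ x) := fun {τ e} hτ he x => by
    have h0 := (gaussianDensity_pos d hτ x).le
    rw [ENNReal.ofReal_rpow_of_nonneg (Real.rpow_nonneg h0 _) he.le, ← Real.rpow_mul h0,
      one_div_mul_cancel he.ne', Real.rpow_one]
  have hN : ∫⁻ y, ‖f y‖ₑ ^ p ∂gaussianMeasure d α = ∫⁻ y, g y ^ p := by
    rw [lintegral_gaussianMeasure]
    refine lintegral_congr fun y => ?_
    rw [ENNReal.mul_rpow_of_nonneg _ _ hp0.le, hrpow hα hp0]
  have hL : ∫⁻ x, (∫⁻ y, ‖mehlerKernel w x y * f y‖ₑ) ^ q ∂gaussianMeasure d β =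
      ∫⁻ x, (∫⁻ y, k x y * g y) ^ q := by
    rw [lintegral_gaussianMeasure]
    refine lintegral_congr fun x => ?_
    rw [← hrpow hβ hq0, ← ENNReal.mul_rpow_of_nonneg _ _ hq0.le,
      ← lintegral_const_mul' _ _ ENNReal.ofReal_ne_top]
    congr 1
    refine lintegral_congr fun y => ?_
    have hα0 := (gaussianDensity_pos d hα y).le
    have hβ0 := (gaussianDensity_pos d hβ x).le
    rw [enorm_mul, ← mul_assoc, ← mul_assoc, ← ofReal_norm (mehlerKernel w x y),
      ← ENNReal.ofReal_mul (Real.rpow_nonneg hβ0 _), ← ENNReal.ofReal_mul (by positivity), hid]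
  have hA : ∀ x, ∫⁻ y, k x y ^ r ≤
      ENNReal.ofReal (c ^ r * (4 * Real.pi / (r * P)) ^ ((d : ℝ) / 2)) := fun x =>
    lintegral_exp_quadratic_rpow_le hP hR hr0 hc x
  -- The quadratic form is symmetric under exchanging `x`, `P` with `y`, `Q`, so the same estimate
  -- serves for the other variable.
  have hB : ∀ y, ∫⁻ x, k x y ^ r ≤
      ENNReal.ofReal (c ^ r * (4 * Real.pi / (r * Q)) ^ ((d : ℝ) / 2)) := fun y => by
    refine le_trans (le_of_eq ?_)
      (lintegral_exp_quadratic_rpow_le (Q := P) (R := R) hQ (by linarith) hr0 hc y)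
    refine lintegral_congr fun x => ?_
    simp only [k]
    rw [real_inner_comm x y]
    ring_nf
  rw [hN, hL]
  refine (schur_test hk hg hp hq hr1 hr hA hB).trans_eq ?_
  have h1p : 0 ≤ 1 - 1 / p := by
    rw [sub_nonneg, div_le_one hp0]; exact hp
  rw [ENNReal.ofReal_rpow_of_nonneg (by positivity) h1p,
    ENNReal.ofReal_rpow_of_nonneg (by positivity) (by positivity),
    ← ENNReal.ofReal_mul (by positivity)]

end MehlerBound

/-! ### Cayley transform identities and the extension to Lebesgue spaces -/

section Extension

variable {d : ℕ}

/-- The real part equals `(1 - |w|²) / |1 + w|²`. -/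
theorem norm_lt_one_of_re_pos {w : ℂ} (h : 0 < ((1 - w) / (1 + w)).re) : ‖w‖ < 1 := by
  rw [Complex.div_re, ← add_div] at h
  have h1 : 0 ≤ Complex.normSq (1 + w) := Complex.normSq_nonneg _
  have h2 := pos_of_mul_pos_left (div_eq_mul_inv _ (Complex.normSq (1 + w)) ▸ h) (inv_nonneg.2 h1)
  simp only [Complex.add_re, Complex.sub_re, Complex.one_re, Complex.add_im, Complex.sub_im,
    Complex.one_im] at h2
  have h3 : ‖w‖ ^ 2 < 1 := by
    rw [← Complex.normSq_eq_norm_sq, Complex.normSq_apply]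
    nlinarith
  nlinarith [norm_nonneg w]

theorem rPlus_cayley {w : ℂ} (h1 : 1 - w ≠ 0) (h2 : 1 + w ≠ 0) :
    rPlus ((1 - w) / (1 + w)) = ((1 + w ^ 2) / (1 - w ^ 2)).re := by
  have h3 : 1 - w ^ 2 ≠ 0 := by
    have : 1 - w ^ 2 = (1 - w) * (1 + w) := by ring
    rw [this]
    exact mul_ne_zero h1 h2
  have e : 1 / ((1 - w) / (1 + w)) + (1 - w) / (1 + w) =
      ((2 : ℝ) : ℂ) * ((1 + w ^ 2) / (1 - w ^ 2)) := by
    push_cast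
    rw [one_div_div, div_add_div _ _ h1 h2, ← mul_div_assoc, div_eq_div_iff (mul_ne_zero h1 h2) h3]
    ring
  rw [rPlus, e, Complex.re_ofReal_mul]
  ring

theorem rMinus_cayley {w : ℂ} (h1 : 1 - w ≠ 0) (h2 : 1 + w ≠ 0) :
    rMinus ((1 - w) / (1 + w)) = (2 * w / (1 - w ^ 2)).re := by
  have h3 : 1 - w ^ 2 ≠ 0 := by
    have : 1 - w ^ 2 = (1 - w) * (1 + w) := by ring
    rw [this]
    exact mul_ne_zero h1 h2
  have e : 1 / ((1 - w) / (1 + w)) - (1 - w) / (1 + w) =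
      ((2 : ℝ) : ℂ) * (2 * w / (1 - w ^ 2)) := by
    push_cast
    rw [one_div_div, div_sub_div _ _ h1 h2, ← mul_div_assoc, div_eq_div_iff (mul_ne_zero h1 h2) h3]
    ring
  rw [rMinus, e, Complex.re_ofReal_mul]
  ring

/-- An integral operator satisfying an `L^p(γ_α)`-to-`L^q(γ_β)` bound defines a linear map
between these spaces. -/
theorem exists_linearMap_of_lintegral_le {p q α β K : ℝ} (hp : 1 ≤ p) (hq : 1 ≤ q) (hα : 0 < α)
    (hβ : 0 < β) (hK : 0 ≤ K)
    {k : EuclideanSpace ℝ (Fin d) → EuclideanSpace ℝ (Fin d) → ℂ}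
    (hk : Continuous (Function.uncurry k))
    (hle : ∀ f : EuclideanSpace ℝ (Fin d) → ℂ, AEStronglyMeasurable f →
      (∫⁻ x, (∫⁻ y, ‖k x y * f y‖ₑ) ^ q ∂gaussianMeasure d β) ^ (1 / q) ≤
        ENNReal.ofReal K * (∫⁻ y, ‖f y‖ₑ ^ p ∂gaussianMeasure d α) ^ (1 / p)) :
    ∃ B : Lp ℂ (ENNReal.ofReal p) (gaussianMeasure d α) →ₗ[ℂ]
        Lp ℂ (ENNReal.ofReal q) (gaussianMeasure d β),
      (∀ v, ‖B v‖ ≤ K * ‖v‖) ∧ ∀ v, B v =ᵐ[volume] fun x => ∫ y, k x y * v y := by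
  have hp0 : 0 < p := by linarith
  have hq0 : 0 < q := by linarith
  have hnorm : ∀ {e τ : ℝ}, 0 < e → ∀ f : EuclideanSpace ℝ (Fin d) → ℂ,
      eLpNorm f (ENNReal.ofReal e) (gaussianMeasure d τ) =
        (∫⁻ x, ‖f x‖ₑ ^ e ∂gaussianMeasure d τ) ^ (1 / e) := fun {e τ} he f => by
    rw [eLpNorm_eq_lintegral_rpow_enorm_toReal (by simpa using he) ENNReal.ofReal_ne_top,
      ENNReal.toReal_ofReal he.le]
  have hα' := absolutelyContinuous_gaussianMeasure d hα
  have hβ' := absolutelyContinuous_gaussianMeasure d hβ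
  have hmeas : ∀ v : Lp ℂ (ENNReal.ofReal p) (gaussianMeasure d α),
      AEStronglyMeasurable v volume := fun v => (Lp.aestronglyMeasurable v).mono_ac hα'
  have hmeas2 : ∀ v : Lp ℂ (ENNReal.ofReal p) (gaussianMeasure d α),
      AEStronglyMeasurable (fun z : EuclideanSpace ℝ (Fin d) × EuclideanSpace ℝ (Fin d) =>
        k z.1 z.2 * v z.2) (volume.prod volume) := fun v =>
    hk.aestronglyMeasurable.mul (hmeas v).comp_snd
  have hfin : ∀ v : Lp ℂ (ENNReal.ofReal p) (gaussianMeasure d α),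
      (∫⁻ x, (∫⁻ y, ‖k x y * v y‖ₑ) ^ q ∂gaussianMeasure d β) ^ (1 / q) ≤
        ENNReal.ofReal K * eLpNorm v (ENNReal.ofReal p) (gaussianMeasure d α) := fun v => by
    rw [hnorm hp0]
    exact hle v (hmeas v)
  -- Finiteness of the `q`-norm makes the kernel integral absolutely convergent for almost every
  -- `x`; without this the Bochner integral need not be additive in `v`.
  have hint : ∀ v : Lp ℂ (ENNReal.ofReal p) (gaussianMeasure d α),
      ∀ᵐ x, Integrable fun y => k x y * v y := fun v => by
    have h1 : ∫⁻ x, (∫⁻ y, ‖k x y * v y‖ₑ) ^ q ∂gaussianMeasure d β ≠ ∞ := by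
      intro h
      have h2 := hfin v
      rw [h, ENNReal.top_rpow_of_pos (by positivity)] at h2
      exact (ENNReal.mul_lt_top ENNReal.ofReal_lt_top (Lp.eLpNorm_lt_top v)).not_ge h2
    have h3 : AEMeasurable (fun x => ∫⁻ y, ‖k x y * v y‖ₑ) (gaussianMeasure d β) :=
      (AEMeasurable.lintegral_prod_right' (hmeas2 v).enorm).mono_ac
        (gaussianMeasure_absolutelyContinuous d β)
    have h4 := hβ' (ae_lt_top' (h3.pow_const q) h1)
    filter_upwards [h4] with x hx
    refine ⟨(hk.comp (by fun_prop : Continuous fun y => (x, y))).aestronglyMeasurable.mul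
      (hmeas v), ?_⟩
    by_contra hcon
    have h5 : ∫⁻ y, ‖k x y * v y‖ₑ = ∞ := not_lt_top_iff.1 hcon
    rw [h5, ENNReal.top_rpow_of_pos hq0] at hx
    exact lt_irrefl _ hx
  have hbound : ∀ v : Lp ℂ (ENNReal.ofReal p) (gaussianMeasure d α),
      eLpNorm (fun x => ∫ y, k x y * v y) (ENNReal.ofReal q) (gaussianMeasure d β) ≤
        ENNReal.ofReal K * eLpNorm v (ENNReal.ofReal p) (gaussianMeasure d α) := fun v => by
    refine le_trans ?_ (hfin v)
    rw [hnorm hq0]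
    refine ENNReal.rpow_le_rpow (lintegral_mono fun x => ?_) (by positivity)
    exact ENNReal.rpow_le_rpow (enorm_integral_le_lintegral_enorm _) hq0.le
  have hmem : ∀ v : Lp ℂ (ENNReal.ofReal p) (gaussianMeasure d α),
      MemLp (fun x => ∫ y, k x y * v y) (ENNReal.ofReal q) (gaussianMeasure d β) := fun v =>
    ⟨(hmeas2 v).integral_prod_right'.mono_ac (gaussianMeasure_absolutelyContinuous d β),
      (hbound v).trans_lt (ENNReal.mul_lt_top ENNReal.ofReal_lt_top (Lp.eLpNorm_lt_top v))⟩
  refine ⟨{ toFun := fun v => (hmem v).toLp _, map_add' := fun u v => ?_,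
            map_smul' := fun c v => ?_ }, fun v => ?_, fun v => hβ' (hmem v).coeFn_toLp⟩
  · rw [← MemLp.toLp_add, MemLp.toLp_eq_toLp_iff]
    refine gaussianMeasure_absolutelyContinuous d β ?_
    filter_upwards [hint u, hint v] with x hu hv
    rw [Pi.add_apply, ← integral_add hu hv]
    refine integral_congr_ae ?_
    filter_upwards [hα' (Lp.coeFn_add u v)] with y hy
    rw [hy, Pi.add_apply, mul_add]
  · rw [RingHom.id_apply, ← MemLp.toLp_const_smul, MemLp.toLp_eq_toLp_iff]
    refine Eventually.of_forall fun x => ?_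
    rw [Pi.smul_apply, ← integral_smul]
    refine integral_congr_ae ?_
    filter_upwards [hα' (Lp.coeFn_smul c v)] with y hy
    rw [hy, Pi.smul_apply, smul_eq_mul, smul_eq_mul]
    ring
  · change ‖(hmem v).toLp _‖ ≤ _
    rw [Lp.norm_toLp, Lp.norm_def]
    refine (ENNReal.toReal_mono (ENNReal.mul_ne_top ENNReal.ofReal_ne_top
      (Lp.eLpNorm_ne_top v)) (hbound v)).trans_eq ?_
    rw [ENNReal.toReal_mul, ENNReal.toReal_ofReal hK]

end Extension

/-! ### Assembly of the main theorem -/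

theorem mainTheorem4 (d : ℕ) (p q r α β : ℝ) (hp : 1 ≤ p) (hq : 1 ≤ q)
    (hr1 : 1 ≤ r) (hr : 1 / r = 1 - (1 / p - 1 / q)) (hα : 0 < α) (hβ : 0 < β)
    (s z : ℂ) (hs : 0 < s.re)
    (h1 : 0 < 1 - 2 / (α * p) + rPlus s)
    (h2 : 0 < 2 / (β * q) - 1 + rPlus s)
    (h3 : rMinus s ^ 2 ≤ (1 - 2 / (α * p) + rPlus s) * (2 / (β * q) - 1 + rPlus s))
    (hz : s = (1 - Complex.exp (-z)) / (1 + Complex.exp (-z))) :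
    (∃! T : GaussL2 d →L[ℂ] GaussL2 d, IsExpNegOU d z T) ∧
    ∀ T : GaussL2 d →L[ℂ] GaussL2 d, IsExpNegOU d z T →
      ExtendsWithNormLE T p α q β
        (2 ^ d * schurConst d p q r α β / ‖1 - Complex.exp (-2 * z)‖ ^ ((d : ℝ) / 2) *
          (1 / ((1 - 2 / (α * p) +
                  ((1 + Complex.exp (-2 * z)) / (1 - Complex.exp (-2 * z))).re)
                    ^ ((d : ℝ) / 2 * (1 - 1 / p)) *
                (2 / (β * q) - 1 +
                  ((1 + Complex.exp (-2 * z)) / (1 - Complex.exp (-2 * z))).re)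
                    ^ ((d : ℝ) / 2 * (1 / q))))) := by

  have h2w : Complex.exp (-2 * z) = Complex.exp (-z) ^ 2 := by
    rw [← Complex.exp_nat_mul]
    congr 1
    push_cast
    ring
  rw [h2w]
  set w := Complex.exp (-z) with hw'
  subst hz
  -- If `w = -1`, the convention `x / 0 = 0` would give `s = 0`, contrary to `0 < s.re`; if `w = 1`,
  -- then `s = 0` as well.
  have hn2 : 1 + w ≠ 0 := fun h => by simp [h] at hs
  have hn1 : 1 - w ≠ 0 := fun h => by simp [h] at hs
  have hw : ‖w‖ < 1 := norm_lt_one_of_re_pos hs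
  have hz : 0 < z.re := by
    rw [hw', Complex.norm_exp, Complex.neg_re, Real.exp_lt_one_iff] at hw
    linarith
  rw [rPlus_cayley hn1 hn2] at h1 h2 h3
  rw [rMinus_cayley hn1 hn2] at h3
  refine ⟨existsUnique_isExpNegOU d hz, fun T hT => ?_⟩
  have hS : 0 ≤ schurConst d p q r α β := by
    rw [schurConst]
    positivity
  obtain ⟨B, hB, hB'⟩ := exists_linearMap_of_lintegral_le hp hq hα hβ (by positivity)
    (continuous_mehlerKernel w) fun f hf =>
      lintegral_mehlerKernel_le hp hq hr1 hr hα hβ hw h1 h2 h3 hf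
  -- Both operators are given by the same kernel integral, so they agree on functions common to the
  -- two spaces.
  refine ⟨B, hB, fun u v huv => (hB' v).trans ?_⟩
  filter_upwards [absolutelyContinuous_gaussianMeasure d one_pos (hT.ae_eq_integral hz u)]
    with x hx
  rw [hx]
  refine integral_congr_ae ?_
  filter_upwards [huv] with y hy
  rw [hy]
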